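/- Conventions. Permutations are multiplied as maps, $(wv)(i)=w(v(i))$; $\ell(w)$ is the least number of adjacent transpositions whose product is $w$. For $p\in\mathfrak S_k$ and $w\in\mathfrak S_n$, the entries $w(i_1),\dots,w(i_k)$ with $i_1<\dots<i_k$ form a $p$-pattern in $w$ if they are in the same relative order as $p(1),\dots,p(k)$. The pair $(p,w)$ is *value-stable* if $w=w'v$ for some $w',v\in\mathfrak S_n$ with $\ell(w)=\ell(w')+\ell(v)$ such that $w'$ has a $p$-pattern in consecutive positions whose values also form a $p$-pattern in $w$. Fix $n$ unit vectors $d_1,\dots,d_n$ in the plane that point strictly downwards and whose directions turn counterclockwise as the index increases. For labels $i_1<\dots<i_k$ and $p\in\mathfrak S_k$, an *$X(p)$ with edges $i_1,\dots,i_k$* is the (possibly degenerate) polygon bounded by two paths that descend from a common top vertex: the left-hand one (which is convex) with successive edges $d_{i_1},\dots,d_{i_k}$, and the right-hand one with successive edges $d_{i_{p(1)}},\dots,d_{i_{p(k)}}$. *Elnitsky's polygon* $X(w)$ is the one with $k=n$ and $p=w\in\mathfrak S_n$; a *rhombus* is an $X(21)$. A *paw tiling* of $X(w)$ is an edge-to-edge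 tiling of $X(w)$ by finitely many such polygons $X(q)$ ($q$ any permutation), called *paws*; degenerate paws are permitted, provided their edges lie along edges of the tiling, and the parts of $X(w)$ where its two sides coincide need not be covered. An $X(p)$-paw in a paw tiling of $X(w)$ is *isolated* if in no paw tiling of $X(w)$ that contains this paw in this position, and whose other tiles are all rhombi, does one of these other rhombi share two edges with the right-hand side of the paw. **Theorem.** For all permutations $p\in\mathfrak S_k$ and $w\in\mathfrak S_n$, there is a paw tiling of $X(w)$ containing an isolated $X(p)$-paw if and only if the pair $(p,w)$ is value-stable. -/

import Mathlib

/-! ### Permutations: length, patterns, value-stable pairs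

Permutations of `{1, …, n}` are elements of `Equiv.Perm (Fin n)` (labels `0, …, n - 1`), multiplied as
maps: `(w * v) i = w (v i)`. -/

/-- `s` is an adjacent transposition. -/
def IsAdjTransposition {n : ℕ} (s : Equiv.Perm (Fin n)) : Prop :=
  ∃ i j : Fin n, (j : ℕ) = (i : ℕ) + 1 ∧ s = Equiv.swap i j

/-- The length of a permutation: the least number of factors in an expression of it as a product of
adjacent transpositions. -/
noncomputable def permLength {n : ℕ} (w : Equiv.Perm (Fin n)) : ℕ :=
  sInf {m | ∃ L : List (Equiv.Perm (Fin n)),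
    L.length = m ∧ (∀ s ∈ L, IsAdjTransposition s) ∧ L.prod = w}

/-- The entries of `w` in the positions `f 0 < f 1 < ⋯ < f (k - 1)` form a `p`-pattern. -/
def IsPatternAt {k n : ℕ} (p : Equiv.Perm (Fin k)) (w : Equiv.Perm (Fin n))
    (f : Fin k ↪o Fin n) : Prop :=
  ∀ i j : Fin k, p i < p j ↔ w (f i) < w (f j)

/-- The positions `f 0 < f 1 < ⋯` are consecutive. -/
def IsConsecutive {k n : ℕ} (f : Fin k ↪o Fin n) : Prop :=
  ∃ x : ℕ, ∀ i : Fin k, (f i : ℕ) = x + (i : ℕ)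

/-- `(p, w)` is value-stable: `w = w' v` with lengths adding, `w'` has a `p`-pattern in consecutive
positions, and the values of this occurrence also form a `p`-pattern in `w`. -/
def ValueStable {k n : ℕ} (p : Equiv.Perm (Fin k)) (w : Equiv.Perm (Fin n)) : Prop :=
  ∃ w' v : Equiv.Perm (Fin n),
    w = w' * v ∧ permLength w = permLength w' + permLength v ∧
    ∃ f' : Fin k ↪o Fin n, IsPatternAt p w' f' ∧ IsConsecutive f' ∧
      ∃ f : Fin k ↪o Fin n, IsPatternAt p w f ∧
        Set.range (fun i => w (f i)) = Set.range (fun i => w' (f' i))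

/-! ### Elnitsky polygons in the plane -/

/-- Admissible edge vectors: `d i` is the vector of a side labelled `i`, traversed downwards. They are
unit vectors pointing strictly downwards, and turn counterclockwise as the label increases, so that the
path with labels in increasing order, read from the top, is the convex left half of a polygon. -/
structure IsEdgeSystem {n : ℕ} (d : Fin n → ℝ × ℝ) : Prop where
  unit : ∀ i, (d i).1 ^ 2 + (d i).2 ^ 2 = 1
  down : ∀ i, (d i).2 < 0
  ccw : ∀ i j, i < j → 0 < (d i).1 * (d j).2 - (d i).2 * (d j).1

/-- The vertex reached from `t` after the first `j` steps of the path with labels `s 0, s 1, …`. -/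
noncomputable def pathVertex {n k : ℕ} (d : Fin n → ℝ × ℝ) (t : ℝ × ℝ) (s : Fin k → Fin n)
    (j : ℕ) : ℝ × ℝ :=
  t + ∑ m ∈ Finset.univ.filter (fun m : Fin k => (m : ℕ) < j), d (s m)

/-- The edges of the path from `t` with labels `s 0, s 1, …`. An edge is recorded by its upper endpoint
and its label. -/
def pathEdges {n k : ℕ} (d : Fin n → ℝ × ℝ) (t : ℝ × ℝ) (s : Fin k → Fin n) :
    Set ((ℝ × ℝ) × Fin n) :=
  Set.range fun m : Fin k => (pathVertex d t s m, s m)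

/-- The points of the path from `t` with labels `s 0, s 1, …`. -/
def pathTrace {n k : ℕ} (d : Fin n → ℝ × ℝ) (t : ℝ × ℝ) (s : Fin k → Fin n) : Set (ℝ × ℝ) :=
  {t} ∪ ⋃ e ∈ pathEdges d t s, segment ℝ e.1 (e.1 + d e.2)

/-- An Elnitsky polygon with edges among the labels `0, …, n - 1`: its top vertex, its labels
`label 0 < ⋯ < label (size - 1)`, and the permutation giving the order of the labels on its
right-hand side. -/
structure ElnitskyPolygon (n : ℕ) where
  size : ℕ
  top : ℝ × ℝ
  label : Fin size ↪o Fin n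
  perm : Equiv.Perm (Fin size)

namespace ElnitskyPolygon

/-- The polygon `X(w)`, with its top vertex at the origin: from the top, its left half has the labels
`0, …, n - 1` and its right half the labels `w 0, …, w (n - 1)`. -/
def X {n : ℕ} (w : Equiv.Perm (Fin n)) : ElnitskyPolygon n :=
  ⟨n, 0, RelEmbedding.refl _, w⟩

variable {n : ℕ} (d : Fin n → ℝ × ℝ) (P : ElnitskyPolygon n)

/-- Edges of the left half: the labels increase from top to bottom. -/
def leftEdges : Set ((ℝ × ℝ) × Fin n) :=
  pathEdges d P.top P.label

/-- Edges of the right half. -/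
def rightEdges : Set ((ℝ × ℝ) × Fin n) :=
  pathEdges d P.top (fun i => P.label (P.perm i))

/-- The closed region enclosed by the left and right halves (both of which descend strictly): the union
of the horizontal segments that join them. -/
def region : Set (ℝ × ℝ) :=
  {z | ∃ l ∈ pathTrace d P.top P.label, ∃ r ∈ pathTrace d P.top (fun i => P.label (P.perm i)),
    l.2 = z.2 ∧ r.2 = z.2 ∧ l.1 ≤ z.1 ∧ z.1 ≤ r.1}

/-- `P` is (a translate, with edges parallel to those with the labels of `P`, of) an `X(p)`. -/
def IsPaw {k : ℕ} (p : Equiv.Perm (Fin k)) : Prop :=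
  ∃ (t : ℝ × ℝ) (l : Fin k ↪o Fin n), P = ⟨k, t, l, p⟩

/-- A rhombus is an `X(21)`. -/
def IsRhombus : Prop :=
  P.IsPaw (Equiv.swap (0 : Fin 2) 1)

end ElnitskyPolygon

open ElnitskyPolygon in
/-- `T` is a paw tiling of `X(w)`: finitely many Elnitsky polygons inside `X(w)`, which cover its
interior, do not overlap, and meet edge to edge. Polygons may be degenerate (the two halves may share
edges or vertices), so degenerate parts of `X(w)` need not be covered, and non-overlapping means that no
tile meets the interior of another one. Edge to edge means that every edge on the right-hand side of a
tile is on the right border of `X(w)` or has another tile on its other side, with that edge on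
its left-hand side only, and symmetrically. -/
structure IsPawTiling {n : ℕ} (d : Fin n → ℝ × ℝ) (w : Equiv.Perm (Fin n))
    (T : Set (ElnitskyPolygon n)) : Prop where
  finite : T.Finite
  inside : ∀ P ∈ T, P.region d ⊆ (X w).region d
  cover : interior ((X w).region d) ⊆ ⋃ P ∈ T, P.region d
  no_overlap : ∀ P ∈ T, ∀ Q ∈ T, P ≠ Q → Disjoint (interior (P.region d)) (Q.region d)
  right_edge : ∀ P ∈ T, ∀ e ∈ P.rightEdges d,
    e ∈ (X w).rightEdges d ∨ ∃ Q ∈ T, e ∈ Q.leftEdges d ∧ e ∉ Q.rightEdges d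
  left_edge : ∀ P ∈ T, ∀ e ∈ P.leftEdges d,
    e ∈ (X w).leftEdges d ∨ ∃ Q ∈ T, e ∈ Q.rightEdges d ∧ e ∉ Q.leftEdges d

/-- `Q` shares two edges with the right-hand side of `P`. -/
def SharesTwoRightEdges {n : ℕ} (d : Fin n → ℝ × ℝ) (Q P : ElnitskyPolygon n) : Prop :=
  ∃ e₁ e₂, e₁ ≠ e₂ ∧ e₁ ∈ Q.leftEdges d ∪ Q.rightEdges d ∧ e₂ ∈ Q.leftEdges d ∪ Q.rightEdges d ∧
    e₁ ∈ P.rightEdges d ∧ e₂ ∈ P.rightEdges d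

/-- The paw `P` of `X(w)` is isolated: in no paw tiling of `X(w)` that contains `P`, all of whose other
tiles are rhombi, does one of these rhombi share two edges with the right-hand side of `P`. -/
def IsIsolatedPaw {n : ℕ} (d : Fin n → ℝ × ℝ) (w : Equiv.Perm (Fin n))
    (P : ElnitskyPolygon n) : Prop :=
  ∀ T : Set (ElnitskyPolygon n), IsPawTiling d w T → P ∈ T →
    (∀ Q ∈ T, Q ≠ P → Q.IsRhombus) →
    ∀ Q ∈ T, Q ≠ P → ¬ SharesTwoRightEdges d Q P

/-!
Reading the labels from top to bottom, a path that descends through a tiling is an arrangement of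
the labels, and pushing the path across a tile to its left replaces the left-hand word of the tile
by its right-hand word, which is a step up in the weak order. Pushing as long as possible, a path
through the right half of a paw reaches the right-hand side of `X(w)`, so it lies below `w` in the
weak order. Conversely, a chain in the weak order from an arrangement to `w` stacks rhombi between
the two paths.

Two adjacent labels of the right half of a paw that occur in the same order in `w` cannot be
exchanged by a rhombus on the right of the paw, whereas two that are ascending in the paw but
descending in `w` can be exchanged first on some chain to `w`. Hence a paw is isolated if and only
if its right-hand labels occur in the same order in `w`.
-/

/-! ### The weak order on lists -/

section WeakOrder

variable {α : Type*}

theorem pair_sublist_cons {x y a : α} {L : List α} :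
    [x, y].Sublist (a :: L) ↔ (x = a ∧ y ∈ L) ∨ [x, y].Sublist L := by
  grind

theorem pair_sublist_append {x y : α} {A B : List α} :
    [x, y].Sublist (A ++ B) ↔ [x, y].Sublist A ∨ (x ∈ A ∧ y ∈ B) ∨ [x, y].Sublist B := by
  induction A with
  | nil => simp
  | cons a A ih =>
    simp only [List.cons_append, pair_sublist_cons, ih, List.mem_append, List.mem_cons]
    tauto

theorem pair_sublist_of_swap {x y a b : α} {A B : List α}
    (h : [x, y].Sublist (A ++ b :: a :: B)) :
    (x = b ∧ y = a) ∨ [x, y].Sublist (A ++ a :: b :: B) := by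
  simp only [pair_sublist_append, pair_sublist_cons, List.mem_cons] at h ⊢
  tauto

theorem pair_sublist_or_swap {x y : α} {W : List α} (h : x ≠ y) (hx : x ∈ W) (hy : y ∈ W) :
    [x, y].Sublist W ∨ [y, x].Sublist W := by
  induction W with
  | nil => simp at hx
  | cons z W ih =>
    simp only [pair_sublist_cons]
    grind

theorem idxOf_lt_of_pair_sublist [DecidableEq α] {x y : α} {W : List α} (hW : W.Nodup)
    (h : [x, y].Sublist W) : W.idxOf x < W.idxOf y := by
  obtain ⟨A, B, rfl, hx, hy⟩ := List.append_sublist_iff.1 (show ([x] ++ [y]).Sublist W from h)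
  rw [List.singleton_sublist] at hx hy
  have hyA : y ∉ A := fun hyA => List.disjoint_of_nodup_append hW hyA hy
  rw [List.idxOf_append_of_mem hx, List.idxOf_append_of_notMem hyA]
  exact (List.idxOf_lt_length_iff.2 hx).trans_le (Nat.le_add_right _ _)

theorem not_pair_sublist_swap {x y : α} {W : List α} (hW : W.Nodup) (h : [x, y].Sublist W) :
    ¬ [y, x].Sublist W := by
  classical
  exact fun h' => lt_asymm (idxOf_lt_of_pair_sublist hW h) (idxOf_lt_of_pair_sublist hW h')

theorem sublist_of_forall_adjacent {R W : List α} (hW : W.Nodup) (hRW : R ⊆ W)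
    (h : ∀ A B a b, R = A ++ a :: b :: B → [a, b].Sublist W) : R.Sublist W := by
  classical
  let r : α → α → Prop := fun x y => W.idxOf x < W.idxOf y
  have : Trans r r r := ⟨fun h₁ h₂ => lt_trans h₁ h₂⟩
  have hR : R.Pairwise r := List.isChain_iff_pairwise.1 <|
    List.isChain_iff_forall_rel_of_append_cons_cons.2 fun {a b A B} e =>
      idxOf_lt_of_pair_sublist hW (h A B a b e)
  have hWr : W.Pairwise r :=
    List.pairwise_iff_forall_sublist.2 fun h => idxOf_lt_of_pair_sublist hW h
  have hnd : R.Nodup := hR.imp fun (hr : r _ _) => ne_of_apply_ne W.idxOf (ne_of_lt hr)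
  have : Std.Antisymm r := ⟨fun _ _ h₁ h₂ => absurd h₁ (lt_asymm h₂)⟩
  exact List.sublist_of_subperm_of_pairwise (hnd.subperm hRW) hR hWr

variable [LinearOrder α]

/-- A cover of the weak order, in one-line notation: `V` arises from `U` by exchanging two adjacent
entries that are in increasing order. -/
def SwapStep (U V : List α) : Prop :=
  ∃ (A B : List α) (a b : α), a < b ∧ U = A ++ a :: b :: B ∧ V = A ++ b :: a :: B

/-- The (right) weak order on the arrangements of a list without repetitions. -/
abbrev WeakLE : List α → List α → Prop :=
  Relation.ReflTransGen SwapStep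

/-- The number of inversions of a list, each recorded at its earlier entry. -/
def invCount : List α → ℕ
  | [] => 0
  | a :: L => L.countP (· < a) + invCount L

theorem SwapStep.perm {U V : List α} (h : SwapStep U V) : U.Perm V := by
  obtain ⟨A, B, a, b, -, rfl, rfl⟩ := h
  exact (List.Perm.swap b a B).append_left A

theorem SwapStep.context {U V : List α} (h : SwapStep U V) (A B : List α) :
    SwapStep (A ++ U ++ B) (A ++ V ++ B) := by
  obtain ⟨A', B', a, b, hab, rfl, rfl⟩ := h
  exact ⟨A ++ A', B' ++ B, a, b, hab, by simp, by simp⟩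

theorem SwapStep.inversion {U V : List α} (h : SwapStep U V) {x y : α} (hxy : x < y)
    (hU : [y, x].Sublist U) : [y, x].Sublist V := by
  obtain ⟨A, B, a, b, hab, rfl, rfl⟩ := h
  rcases pair_sublist_of_swap hU with ⟨rfl, rfl⟩ | h
  · exact absurd hab (lt_asymm hxy)
  · exact h

theorem SwapStep.invCount_eq {U V : List α} (h : SwapStep U V) : invCount V = invCount U + 1 := by
  obtain ⟨A, B, a, b, hab, rfl, rfl⟩ := h
  induction A with
  | nil =>
    simp only [List.nil_append, invCount, List.countP_cons, hab, hab.not_gt, decide_true,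
      decide_false, Bool.false_eq_true, if_true, if_false]
    omega
  | cons z A ih =>
    have := ((List.Perm.swap b a B).append_left A).countP_eq (· < z)
    simp only [List.cons_append, invCount, ih, this]
    omega

theorem WeakLE.perm {U V : List α} (h : WeakLE U V) : U.Perm V := by
  induction h with
  | refl => exact List.Perm.refl _
  | tail _ h ih => exact ih.trans h.perm

theorem WeakLE.context {U V : List α} (h : WeakLE U V) (A B : List α) :
    WeakLE (A ++ U ++ B) (A ++ V ++ B) :=
  Relation.ReflTransGen.lift (fun X => A ++ X ++ B) (fun _ _ h => SwapStep.context h A B) _ _ h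

theorem WeakLE.inversion {U V : List α} (h : WeakLE U V) {x y : α} (hxy : x < y)
    (hU : [y, x].Sublist U) : [y, x].Sublist V := by
  induction h with
  | refl => exact hU
  | tail _ h ih => exact h.inversion hxy ih

theorem WeakLE.invCount_lt {U V : List α} (h : WeakLE U V) (hne : U ≠ V) :
    invCount U < invCount V := by
  have hle : ∀ {U V : List α}, WeakLE U V → invCount U ≤ invCount V := fun h => by
    induction h with
    | refl => exact le_rfl
    | tail _ h ih => exact ih.trans (h.invCount_eq ▸ Nat.le_succ _)
  obtain ⟨U', hs, h'⟩ := (Relation.ReflTransGen.cases_head h).resolve_left hne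
  exact (hs.invCount_eq ▸ Nat.lt_succ_self _ : invCount U < invCount U').trans_le (hle h')

theorem invCount_le_sq (U : List α) : invCount U ≤ U.length ^ 2 := by
  induction U with
  | nil => simp [invCount]
  | cons a U ih =>
    have := List.countP_le_length (p := (· < a)) (l := U)
    simp only [invCount, List.length_cons]
    nlinarith

theorem weakLE_of_inversions {U W : List α} (hW : W.Nodup) (hp : U.Perm W)
    (h : ∀ x y, x < y → [y, x].Sublist U → [y, x].Sublist W) : WeakLE U W := by
  induction hm : W.length ^ 2 - invCount U using Nat.strong_induction_on generalizing U with
  | _ m ih =>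
    by_cases hex : ∃ (A B : List α) (a b : α), U = A ++ a :: b :: B ∧ a < b ∧ [b, a].Sublist W
    · obtain ⟨A, B, a, b, rfl, hab, hba⟩ := hex
      have hs : SwapStep (A ++ a :: b :: B) (A ++ b :: a :: B) := ⟨A, B, a, b, hab, rfl, rfl⟩
      have hp' := hs.perm.symm.trans hp
      have hcount := hs.invCount_eq
      have hle := invCount_le_sq (A ++ b :: a :: B)
      rw [hp'.length_eq] at hle
      refine .head hs (ih _ (by omega) hp' (fun x y hxy hyx => ?_) rfl)
      rcases pair_sublist_of_swap hyx with ⟨rfl, rfl⟩ | h'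
      · exact hba
      · exact h x y hxy h'
    · have hU : U.Nodup := hp.nodup_iff.2 hW
      have hsub : U.Sublist W := by
        refine sublist_of_forall_adjacent hW hp.subset ?_
        rintro A B a b rfl
        have hne : a ≠ b := by
          rintro rfl
          simp [List.nodup_append] at hU
        rcases lt_or_gt_of_ne hne with hab | hab
        · exact (pair_sublist_or_swap hne (hp.subset (by simp)) (hp.subset (by simp))).resolve_right
            fun h' => hex ⟨A, B, a, b, rfl, hab, h'⟩
        · exact h b a hab (by simp)
      rw [hsub.eq_of_length hp.length_eq]

theorem weakLE_of_pairwise_lt {L R : List α} (hL : L.Pairwise (· < ·)) (hp : L.Perm R) :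
    WeakLE L R :=
  weakLE_of_inversions (hp.nodup_iff.1 (hL.imp ne_of_lt)) hp fun _ _ hxy h =>
    absurd (List.pairwise_iff_forall_sublist.1 hL h) (lt_asymm hxy)

theorem WeakLE.swap_of_inversion {A B W : List α} {a b : α} (hW : W.Nodup)
    (h : WeakLE (A ++ a :: b :: B) W) (hba : [b, a].Sublist W) : WeakLE (A ++ b :: a :: B) W := by
  have hp : (A ++ b :: a :: B).Perm W := ((List.Perm.swap a b B).append_left A).trans h.perm
  refine weakLE_of_inversions hW hp fun x y hxy hyx => ?_
  rcases pair_sublist_of_swap hyx with ⟨rfl, rfl⟩ | h'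
  · exact hba
  · exact h.inversion hxy h'

theorem invCount_eq_zero_of_pairwise_lt {L : List α} (hL : L.Pairwise (· < ·)) :
    invCount L = 0 := by
  induction L with
  | nil => rfl
  | cons a L ih =>
    rw [List.pairwise_cons] at hL
    simp only [invCount, ih hL.2, add_zero, List.countP_eq_zero, decide_eq_true_eq, not_lt]
    exact fun b hb => (hL.1 b hb).le

end WeakOrder

/-! ### Length-additive factorizations -/

section PermLength

variable {n : ℕ}

theorem exists_perm_ofFn_eq {u : Equiv.Perm (Fin n)} {V : List (Fin n)}
    (h : (List.ofFn u).Perm V) : ∃ v : Equiv.Perm (Fin n), List.ofFn v = V := by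
  have hl : V.length = n := by rw [← h.length_eq, List.length_ofFn]
  have hn : V.Nodup := h.nodup_iff.1 (List.nodup_ofFn.2 u.injective)
  have hg : Function.Injective (fun i : Fin n => V.get (i.cast hl.symm)) :=
    (List.nodup_iff_injective_get.1 hn).comp (Fin.cast_injective _)
  refine ⟨Equiv.ofBijective _ (Finite.injective_iff_bijective.1 hg), ?_⟩
  apply List.ext_getElem <;> simp [hl]

theorem perm_ext_ofFn {u v : Equiv.Perm (Fin n)} (h : List.ofFn u = List.ofFn v) : u = v :=
  DFunLike.coe_injective (List.ofFn_injective h)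

theorem ofFn_swap_mul {u : Equiv.Perm (Fin n)} {A B : List (Fin n)} {a b : Fin n}
    (h : List.ofFn u = A ++ a :: b :: B) :
    List.ofFn (Equiv.swap a b * u) = A ++ b :: a :: B := by
  have hnd : (A ++ a :: b :: B).Nodup := h ▸ List.nodup_ofFn.2 u.injective
  have hfix : ∀ L : List (Fin n), a ∉ L → b ∉ L → L.map (Equiv.swap a b) = L := fun L ha hb =>
    (List.map_congr_left fun c hc => Equiv.swap_apply_of_ne_of_ne
      (ne_of_mem_of_not_mem hc ha) (ne_of_mem_of_not_mem hc hb)).trans L.map_id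
  rw [Equiv.Perm.coe_mul, ← List.map_ofFn, h, List.map_append, List.map_cons, List.map_cons,
    Equiv.swap_apply_left, Equiv.swap_apply_right, hfix A, hfix B] <;> grind

theorem exists_ofFn_eq_append {α : Type*} (u : Fin n → α) {i j : Fin n} (hij : (j : ℕ) = i + 1) :
    ∃ A B : List α, List.ofFn u = A ++ u i :: u j :: B := by
  have hj : (i : ℕ) + 1 < (List.ofFn u).length := by simp [← hij]
  refine ⟨(List.ofFn u).take i, (List.ofFn u).drop (i + 2), ?_⟩
  conv_lhs => rw [← List.take_append_drop i (List.ofFn u),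
    List.drop_eq_getElem_cons (Nat.lt_of_succ_lt hj), List.drop_eq_getElem_cons hj]
  simp only [List.getElem_ofFn, Fin.eta, ← hij]
  rw [show (j : ℕ) + 1 = i + 2 by omega]

theorem IsAdjTransposition.swapStep (u : Equiv.Perm (Fin n)) {s : Equiv.Perm (Fin n)}
    (hs : IsAdjTransposition s) :
    SwapStep (List.ofFn u) (List.ofFn (u * s)) ∨ SwapStep (List.ofFn (u * s)) (List.ofFn u) := by
  obtain ⟨i, j, hij, rfl⟩ := hs
  obtain ⟨A, B, hu⟩ := exists_ofFn_eq_append u hij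
  have hus := ofFn_swap_mul hu
  rw [← Equiv.mul_swap_eq_swap_mul] at hus
  have hne : u i ≠ u j := u.injective.ne fun h => by rw [h] at hij; omega
  rcases lt_or_gt_of_ne hne with h | h
  · exact .inl ⟨A, B, _, _, h, hu, hus⟩
  · exact .inr ⟨A, B, _, _, h, hus, hu⟩

theorem exists_adjTransposition_of_swapStep {u v : Equiv.Perm (Fin n)}
    (h : SwapStep (List.ofFn u) (List.ofFn v)) :
    ∃ s, IsAdjTransposition s ∧ v = u * s := by
  obtain ⟨A, B, a, b, -, hu, hv⟩ := h
  have hlen : A.length + (B.length + 2) = n := by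
    simpa using (congrArg List.length hu).symm
  have hget : ∀ (i : Fin n) (hi : (i : ℕ) < (A ++ a :: b :: B).length),
      u i = (A ++ a :: b :: B)[(i : ℕ)] := fun i hi => by
    rw [← List.getElem_of_eq hu (by simp), List.getElem_ofFn]
  let i : Fin n := ⟨A.length, by omega⟩
  let j : Fin n := ⟨A.length + 1, by omega⟩
  have hi : u i = a := by simp [hget i (by simp [i]), i]
  have hj : u j = b := by simp [hget j (by simp [j]), j]
  refine ⟨Equiv.swap i j, ⟨i, j, rfl, rfl⟩, ?_⟩
  rw [Equiv.mul_swap_eq_swap_mul, hi, hj]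
  exact perm_ext_ofFn (hv.trans (ofFn_swap_mul hu).symm)

theorem invCount_mul_prod_le (u : Equiv.Perm (Fin n)) (M : List (Equiv.Perm (Fin n)))
    (hM : ∀ s ∈ M, IsAdjTransposition s) :
    invCount (List.ofFn (u * M.prod)) ≤ invCount (List.ofFn u) + M.length := by
  induction M generalizing u with
  | nil => simp
  | cons s M ih =>
    rw [List.forall_mem_cons] at hM
    have hrest := ih (u * s) hM.2
    rw [List.prod_cons, ← mul_assoc, List.length_cons]
    rcases hM.1.swapStep u with h | h <;> have := h.invCount_eq <;> omega

theorem weakLE_mul_prod (u : Equiv.Perm (Fin n)) (M : List (Equiv.Perm (Fin n)))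
    (hM : ∀ s ∈ M, IsAdjTransposition s)
    (h : invCount (List.ofFn u) + M.length ≤ invCount (List.ofFn (u * M.prod))) :
    WeakLE (List.ofFn u) (List.ofFn (u * M.prod)) := by
  induction M generalizing u with
  | nil => rw [List.prod_nil, mul_one]
  | cons s M ih =>
    rw [List.forall_mem_cons] at hM
    have hle := invCount_mul_prod_le (u * s) M hM.2
    rw [List.prod_cons, ← mul_assoc] at h ⊢
    rw [List.length_cons] at h
    rcases hM.1.swapStep u with hs | hs <;> have hcount := hs.invCount_eq
    · exact .head hs (ih (u * s) hM.2 (by omega))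
    · omega

theorem exists_word_of_weakLE {u w : Equiv.Perm (Fin n)}
    (h : WeakLE (List.ofFn u) (List.ofFn w)) :
    ∃ M : List (Equiv.Perm (Fin n)), (∀ s ∈ M, IsAdjTransposition s) ∧ u * M.prod = w ∧
      invCount (List.ofFn u) + M.length = invCount (List.ofFn w) := by
  generalize hV : List.ofFn w = V at h ⊢
  induction h generalizing w with
  | refl => exact ⟨[], by simp, by simpa using (perm_ext_ofFn hV).symm, by simp⟩
  | tail h hs ih =>
    obtain ⟨v, rfl⟩ := exists_perm_ofFn_eq (WeakLE.perm h)
    obtain ⟨M, hM, rfl, hlen⟩ := ih rfl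
    subst hV
    obtain ⟨s, hadj, rfl⟩ := exists_adjTransposition_of_swapStep hs
    refine ⟨M ++ [s], ?_, by simp [mul_assoc], ?_⟩
    · simpa only [List.forall_mem_append, List.forall_mem_singleton] using ⟨hM, hadj⟩
    · rw [hs.invCount_eq, ← hlen, List.length_append, List.length_singleton, add_assoc]

theorem permLength_le_of_word {w : Equiv.Perm (Fin n)} {M : List (Equiv.Perm (Fin n))}
    (hM : ∀ s ∈ M, IsAdjTransposition s) (h : M.prod = w) : permLength w ≤ M.length :=
  Nat.sInf_le ⟨M, rfl, hM, h⟩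

theorem pairwise_lt_ofFn_one : (List.ofFn (1 : Equiv.Perm (Fin n))).Pairwise (· < ·) :=
  List.pairwise_ofFn.2 fun _ _ h => h

theorem weakLE_ofFn_one (w : Equiv.Perm (Fin n)) :
    WeakLE (List.ofFn (1 : Equiv.Perm (Fin n))) (List.ofFn w) :=
  weakLE_of_pairwise_lt pairwise_lt_ofFn_one
    (Equiv.Perm.ofFn_comp_perm w (1 : Equiv.Perm (Fin n))).symm

theorem exists_reduced_word (w : Equiv.Perm (Fin n)) :
    ∃ M : List (Equiv.Perm (Fin n)), M.length = permLength w ∧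
      (∀ s ∈ M, IsAdjTransposition s) ∧ M.prod = w := by
  obtain ⟨M, hM, h, -⟩ := exists_word_of_weakLE (weakLE_ofFn_one w)
  exact Nat.sInf_mem (s := {m | ∃ L : List (Equiv.Perm (Fin n)),
    L.length = m ∧ (∀ s ∈ L, IsAdjTransposition s) ∧ L.prod = w})
    ⟨M.length, M, rfl, hM, by rw [← h, one_mul]⟩

theorem permLength_eq_invCount (w : Equiv.Perm (Fin n)) :
    permLength w = invCount (List.ofFn w) := by
  have hone := invCount_eq_zero_of_pairwise_lt (pairwise_lt_ofFn_one (n := n))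
  apply le_antisymm
  · obtain ⟨M, hM, hw, hlen⟩ := exists_word_of_weakLE (weakLE_ofFn_one w)
    rw [one_mul] at hw
    have := permLength_le_of_word hM hw
    omega
  · obtain ⟨M, hlen, hM, hw⟩ := exists_reduced_word w
    have := invCount_mul_prod_le 1 M hM
    rw [one_mul, hw] at this
    omega

theorem weakLE_iff_permLength_add {u v : Equiv.Perm (Fin n)} :
    WeakLE (List.ofFn u) (List.ofFn (u * v)) ↔
      permLength (u * v) = permLength u + permLength v := by
  obtain ⟨N, hlen, hN, hprod⟩ := exists_reduced_word v
  rw [permLength_eq_invCount u, permLength_eq_invCount (u * v), ← hlen, ← hprod]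
  refine ⟨fun h => (invCount_mul_prod_le u N hN).antisymm ?_, fun h => weakLE_mul_prod u N hN h.ge⟩
  obtain ⟨M, hM, hMprod, hMlen⟩ := exists_word_of_weakLE h
  rw [hlen, ← hMlen]
  exact Nat.add_le_add_left
    (permLength_le_of_word hM (mul_left_cancel (hMprod.trans (by rw [hprod])))) _

end PermLength

/-! ### Value-stability in terms of weak-order paths -/

section ValueStable

variable {α : Type*} {k n : ℕ}

theorem ofFn_sublist_ofFn_iff {g : Fin k → α} {h : Fin n → α} :
    (List.ofFn g).Sublist (List.ofFn h) ↔ ∃ f : Fin k ↪o Fin n, ∀ i, h (f i) = g i := by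
  rw [List.sublist_iff_exists_fin_orderEmbedding_get_eq]
  let eg := Fin.castOrderIso (List.length_ofFn (f := g))
  let eh := Fin.castOrderIso (List.length_ofFn (f := h))
  constructor
  · rintro ⟨f, hf⟩
    refine ⟨(eg.symm.toOrderEmbedding.trans f).trans eh.toOrderEmbedding, fun i => ?_⟩
    exact ((List.get_ofFn h _).symm.trans (hf (eg.symm i)).symm).trans (List.get_ofFn g _)
  · rintro ⟨f, hf⟩
    refine ⟨(eg.toOrderEmbedding.trans f).trans eh.symm.toOrderEmbedding, fun i => ?_⟩
    exact ((List.get_ofFn g _).trans (hf (eg i)).symm).trans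
      (List.get_ofFn h (eh.symm (f (eg i)))).symm

theorem ofFn_infix_ofFn_iff {g : Fin k → α} {h : Fin n → α} :
    List.ofFn g <:+: List.ofFn h ↔
      ∃ f : Fin k ↪o Fin n, IsConsecutive f ∧ ∀ i, h (f i) = g i := by
  rw [List.infix_iff_getElem?]
  simp only [List.length_ofFn]
  constructor
  · rintro ⟨x, hx, hget⟩
    let f : Fin k → Fin n := fun i => ⟨x + i, by omega⟩
    have hf : StrictMono f := fun i j hij => Fin.mk_lt_mk.2 (Nat.add_lt_add_left hij x)
    refine ⟨OrderEmbedding.ofStrictMono f hf, ⟨x, fun i => rfl⟩, fun i => ?_⟩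
    simpa [add_comm, (f i).isLt, f, show x + (i : ℕ) < n by omega] using hget i i.isLt
  · rintro ⟨f, ⟨x, hx⟩, hf⟩
    rcases k.eq_zero_or_pos with rfl | hk
    · exact ⟨0, by simp⟩
    · have hlast := hx ⟨k - 1, by omega⟩
      refine ⟨x, by grind, fun i hi => ?_⟩
      simp [← hf, ← hx ⟨i, hi⟩, add_comm]

theorem isPatternAt_iff {p : Equiv.Perm (Fin k)} {w : Equiv.Perm (Fin n)} {f : Fin k ↪o Fin n} :
    IsPatternAt p w f ↔ ∃ l : Fin k ↪o Fin n, ∀ i, w (f i) = l (p i) := by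
  constructor
  · intro h
    have hmono : StrictMono fun i => w (f (p.symm i)) := fun i j hij =>
      (h _ _).1 (by simpa only [Equiv.apply_symm_apply] using hij)
    exact ⟨OrderEmbedding.ofStrictMono _ hmono, by simp⟩
  · rintro ⟨l, hl⟩ i j
    rw [hl, hl, l.lt_iff_lt]

theorem valueStable_iff {p : Equiv.Perm (Fin k)} {w : Equiv.Perm (Fin n)} :
    ValueStable p w ↔ ∃ (l : Fin k ↪o Fin n) (V : List (Fin n)), WeakLE V (List.ofFn w) ∧
      List.ofFn (l ∘ p) <:+: V ∧ (List.ofFn (l ∘ p)).Sublist (List.ofFn w) := by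
  constructor
  · rintro ⟨u, v, rfl, hlen, f', hf', hcons, f, hf, hrange⟩
    obtain ⟨l, hl⟩ := isPatternAt_iff.1 hf'
    obtain ⟨m, hm⟩ := isPatternAt_iff.1 hf
    have hlm : l = m := by
      simp only [hm, hl] at hrange
      refine OrderEmbedding.range_inj.1 ?_
      rw [← p.surjective.range_comp l, ← p.surjective.range_comp m]
      exact hrange.symm
    exact ⟨l, List.ofFn u, weakLE_iff_permLength_add.2 hlen,
      ofFn_infix_ofFn_iff.2 ⟨f', hcons, hl⟩, ofFn_sublist_ofFn_iff.2 ⟨f, hlm ▸ hm⟩⟩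
  · rintro ⟨l, V, hV, hinfix, hsub⟩
    obtain ⟨u, rfl⟩ := exists_perm_ofFn_eq hV.perm.symm
    obtain ⟨f', hcons, hf'⟩ := ofFn_infix_ofFn_iff.1 hinfix
    obtain ⟨f, hf⟩ := ofFn_sublist_ofFn_iff.1 hsub
    rw [← mul_inv_cancel_left u w] at hV
    refine ⟨u, u⁻¹ * w, (mul_inv_cancel_left u w).symm, ?_, f', isPatternAt_iff.2 ⟨l, hf'⟩, hcons,
      f, isPatternAt_iff.2 ⟨l, hf⟩, ?_⟩
    · rw [← weakLE_iff_permLength_add.1 hV, mul_inv_cancel_left]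
    · simp only [hf, hf']

end ValueStable

/-! ### Descending edge paths given by lists of labels -/

section LabelPaths

variable {ι : Type*} {d : ι → ℝ × ℝ}

/-- The displacement along a path whose edges have the labels `L`. -/
def labelSum (d : ι → ℝ × ℝ) (L : List ι) : ℝ × ℝ :=
  (L.map d).sum

@[simp]
theorem labelSum_nil : labelSum d [] = 0 := rfl

@[simp]
theorem labelSum_cons (a : ι) (L : List ι) : labelSum d (a :: L) = d a + labelSum d L := by
  simp [labelSum]

@[simp]
theorem labelSum_append (A B : List ι) : labelSum d (A ++ B) = labelSum d A + labelSum d B := by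
  simp [labelSum]

theorem labelSum_perm {L R : List ι} (h : L.Perm R) : labelSum d L = labelSum d R :=
  (h.map d).sum_eq

theorem labelSum_snd_nonpos (hd : ∀ i, (d i).2 < 0) (L : List ι) : (labelSum d L).2 ≤ 0 := by
  induction L with
  | nil => simp
  | cons a L ih =>
    rw [labelSum_cons, Prod.snd_add]
    linarith [hd a]

theorem labelSum_snd_neg (hd : ∀ i, (d i).2 < 0) {L : List ι} (hL : L ≠ []) :
    (labelSum d L).2 < 0 := by
  obtain ⟨a, L, rfl⟩ := List.exists_cons_of_ne_nil hL
  rw [labelSum_cons, Prod.snd_add]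
  linarith [hd a, labelSum_snd_nonpos hd L]

theorem eq_nil_of_labelSum_snd_eq_zero (hd : ∀ i, (d i).2 < 0) {L : List ι}
    (h : (labelSum d L).2 = 0) : L = [] :=
  not_imp_comm.1 (labelSum_snd_neg hd) h.not_lt

theorem append_inj_of_labelSum_snd (hd : ∀ i, (d i).2 < 0) {A B A' B' : List ι}
    (h : A ++ B = A' ++ B') (hs : (labelSum d A).2 = (labelSum d A').2) : A = A' ∧ B = B' := by
  rcases List.append_eq_append_iff.1 h with ⟨C, rfl, rfl⟩ | ⟨C, rfl, rfl⟩ <;>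
  · obtain rfl := eq_nil_of_labelSum_snd_eq_zero hd (L := C) (by simpa using hs)
    simp

/-- The edges of the path from `t` with the labels `L`, recorded as in `pathEdges`. -/
def listEdges (d : ι → ℝ × ℝ) : ℝ × ℝ → List ι → Set ((ℝ × ℝ) × ι)
  | _, [] => ∅
  | t, a :: L => insert (t, a) (listEdges d (t + d a) L)

@[simp]
theorem listEdges_nil (t : ℝ × ℝ) : listEdges d t [] = ∅ := rfl

@[simp]
theorem listEdges_cons (t : ℝ × ℝ) (a : ι) (L : List ι) :
    listEdges d t (a :: L) = insert (t, a) (listEdges d (t + d a) L) := rfl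

theorem listEdges_append (t : ℝ × ℝ) (A B : List ι) :
    listEdges d t (A ++ B) = listEdges d t A ∪ listEdges d (t + labelSum d A) B := by
  induction A generalizing t with
  | nil => simp
  | cons a A ih => simp [ih, Set.insert_union, add_assoc]

theorem mem_listEdges_iff {t v : ℝ × ℝ} {a : ι} {L : List ι} :
    (v, a) ∈ listEdges d t L ↔ ∃ A B, L = A ++ a :: B ∧ v = t + labelSum d A := by
  constructor
  · induction L generalizing t with
    | nil => simp
    | cons b L ih =>
      rintro (h | h)
      · obtain ⟨rfl, rfl⟩ := Prod.mk.inj h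
        exact ⟨[], L, rfl, by simp⟩
      · obtain ⟨A, B, rfl, rfl⟩ := ih h
        exact ⟨b :: A, B, rfl, by simp [add_assoc]⟩
  · rintro ⟨A, B, rfl, rfl⟩
    simp [listEdges_append]

theorem exists_divergence (hd : ∀ i, (d i).2 < 0) {U W : List ι} (hne : U ≠ W)
    (hsum : labelSum d U = labelSum d W) :
    ∃ A g U' h W', g ≠ h ∧ U = A ++ g :: U' ∧ W = A ++ h :: W' := by
  induction U generalizing W with
  | nil => exact absurd (eq_nil_of_labelSum_snd_eq_zero hd (by simp [← hsum])).symm hne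
  | cons g U ih =>
    rcases W with _ | ⟨h, W⟩
    · exact absurd (eq_nil_of_labelSum_snd_eq_zero hd (by simp [hsum])) hne
    · by_cases e : g = h
      · subst e
        obtain ⟨A, x, U', y, W', hxy, rfl, rfl⟩ := ih (by simpa using hne) (by simpa using hsum)
        exact ⟨g :: A, x, U', y, W', hxy, rfl, rfl⟩
      · exact ⟨[], g, U, h, W, e, rfl, rfl⟩

end LabelPaths

/-! ### Pushing paths across tiles -/

section TileComplex

/-- A polygon bounded by two descending paths from a common top vertex, given by their labels. -/
structure ListTile (ι : Type*) where
  top : ℝ × ℝ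
  left : List ι
  right : List ι

variable {ι : Type*}

/-- The edges on the path `W` from the origin and those on the left-hand sides of the tiles: where a
path along such edges leaves `W`, it can be pushed to the right across a tile. -/
def goodEdges (d : ι → ℝ × ℝ) (W : List ι) (𝒞 : Set (ListTile ι)) : Set ((ℝ × ℝ) × ι) :=
  listEdges d 0 W ∪ ⋃ C ∈ 𝒞, listEdges d C.top C.left

variable [LinearOrder ι]

/-- The combinatorial properties of a tiling with right border `W` that allow one to push any edge
path across the tiles to `W`. The tiles here are polygons whose two sides meet only at their
ends. -/
structure IsTileComplex (d : ι → ℝ × ℝ) (W : List ι) (𝒞 : Set (ListTile ι)) : Prop where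
  finite : (goodEdges d W 𝒞).Finite
  sorted : ∀ C ∈ 𝒞, C.left.Pairwise (· < ·)
  perm : ∀ C ∈ 𝒞, C.left.Perm C.right
  head_lt : ∀ C ∈ 𝒞, ∀ a L b R, C.left = a :: L → C.right = b :: R → a < b
  last_lt : ∀ C ∈ 𝒞, ∀ a L b R, C.left = L ++ [a] → C.right = R ++ [b] → b < a
  next_eq : ∀ C ∈ 𝒞, ∀ C' ∈ 𝒞, ∀ A a B A' a' B', A ≠ [] → A' ≠ [] → C.left = A ++ a :: B →
    C'.left = A' ++ a' :: B' → C.top + labelSum d A = C'.top + labelSum d A' → a = a'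
  not_border : ∀ C ∈ 𝒞, ∀ A B A' B', A ≠ [] → B ≠ [] → C.left = A ++ B → W = A' ++ B' →
    C.top + labelSum d A ≠ labelSum d A'
  right_good : ∀ C ∈ 𝒞, listEdges d C.top C.right ⊆ goodEdges d W 𝒞

variable {d : ι → ℝ × ℝ} {W : List ι} {𝒞 : Set (ListTile ι)}

namespace IsTileComplex

theorem eq_or_exists_tile_below (h𝒞 : IsTileComplex d W 𝒞) {C : ListTile ι} (hC : C ∈ 𝒞)
    {A B : List ι} {a g : ι} (hA : A ≠ []) (hleft : C.left = A ++ a :: B)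
    (hg : (C.top + labelSum d A, g) ∈ goodEdges d W 𝒞) :
    g = a ∨ ∃ C' ∈ 𝒞, C'.top = C.top + labelSum d A ∧ ∃ L, C'.left = g :: L := by
  simp only [goodEdges, Set.mem_union, Set.mem_iUnion, exists_prop, mem_listEdges_iff] at hg
  rcases hg with ⟨A', B', hW, hv⟩ | ⟨C', hC', A', B', hleft', hv⟩
  · exact absurd (by simpa using hv)
      (h𝒞.not_border C hC A _ A' _ hA (List.cons_ne_nil a B) hleft hW)
  · rcases eq_or_ne A' [] with rfl | hA'
    · exact .inr ⟨C', hC', by simpa using hv.symm, B', hleft'⟩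
    · exact .inl (h𝒞.next_eq C hC C' hC' A a B A' g B' hA hA' hleft hleft' hv).symm

theorem exists_tile_along (h𝒞 : IsTileComplex d W 𝒞) {U : List ι}
    (hgood : listEdges d 0 U ⊆ goodEdges d W 𝒞) (hend : labelSum d U = labelSum d W)
    {C : ListTile ι} (hC : C ∈ 𝒞) {A V L : List ι} {g : ι} (hU : U = A ++ g :: V)
    (htop : C.top = labelSum d A) (hleft : C.left = g :: L) :
    ∃ C ∈ 𝒞, C.left ≠ [] ∧ ∃ A B, U = A ++ C.left ++ B ∧ C.top = labelSum d A := by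
  induction hm : V.length using Nat.strong_induction_on generalizing C A V L g with
  | _ m ih =>
    by_contra hno
    have hfollow : ∀ M N, C.left = M ++ N → M ≠ [] → ∃ V', U = A ++ M ++ V' := by
      intro M
      induction M using List.reverseRecOn with
      | nil => exact fun N _ h => absurd rfl h
      | append_singleton M a ihM =>
        intro N hMN _
        rcases eq_or_ne M [] with rfl | hM
        · obtain ⟨rfl, -⟩ : g = a ∧ L = N := by simpa [hleft] using hMN
          exact ⟨V, by simpa using hU⟩
        rw [List.append_assoc, List.singleton_append] at hMN
        obtain ⟨V', hV'⟩ := ihM _ hMN hM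
        have hv : C.top + labelSum d M = labelSum d (A ++ M) := by rw [htop, labelSum_append]
        rcases V' with _ | ⟨g', V''⟩
        · refine absurd ?_ (h𝒞.not_border C hC M _ W [] hM (List.cons_ne_nil a N) hMN (by simp))
          rw [hv, ← hend, hV', List.append_nil]
        have hg' : (C.top + labelSum d M, g') ∈ goodEdges d W 𝒞 :=
          hgood (mem_listEdges_iff.2 ⟨A ++ M, V'', hV', by rw [hv, zero_add]⟩)
        rcases h𝒞.eq_or_exists_tile_below hC hM hMN hg' with rfl | ⟨C', hC', htop', L', hleft'⟩
        · exact ⟨V'', by simpa using hV'⟩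
        · refine absurd (ih V''.length ?_ hC' hV' (htop'.trans hv) hleft' rfl) hno
          have hlen := congrArg List.length (hU.symm.trans hV')
          have := List.length_pos_iff.2 hM
          simp only [List.length_append, List.length_cons] at hlen
          omega
    have hne : C.left ≠ [] := hleft ▸ List.cons_ne_nil g L
    obtain ⟨V', hV'⟩ := hfollow C.left [] (by simp) hne
    exact hno ⟨C, hC, hne, A, V', hV', htop⟩

theorem exists_tile_along_of_ne (hd : ∀ i, (d i).2 < 0) (h𝒞 : IsTileComplex d W 𝒞) {U : List ι}
    (hgood : listEdges d 0 U ⊆ goodEdges d W 𝒞) (hend : labelSum d U = labelSum d W)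
    (hne : U ≠ W) :
    ∃ C ∈ 𝒞, C.left ≠ [] ∧ ∃ A B, U = A ++ C.left ++ B ∧ C.top = labelSum d A := by
  obtain ⟨A, g, U', h, W', hgh, hU, hW⟩ := exists_divergence hd hne hend
  have hg := hgood (mem_listEdges_iff.2 ⟨A, U', hU, rfl⟩)
  simp only [goodEdges, Set.mem_union, Set.mem_iUnion, exists_prop, mem_listEdges_iff,
    zero_add] at hg
  rcases hg with ⟨A', B', hW', hA'⟩ | ⟨C, hC, A', B', hleft, hv⟩
  · obtain ⟨-, h'⟩ := append_inj_of_labelSum_snd hd (hW.symm.trans hW') (by rw [hA'])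
    exact absurd (List.cons.inj h').1.symm hgh
  · rcases eq_or_ne A' [] with rfl | hne'
    · exact h𝒞.exists_tile_along hgood hend hC hU (by simpa using hv.symm) hleft
    · exact absurd hv.symm
        (h𝒞.not_border C hC A' _ A _ hne' (List.cons_ne_nil g B') hleft hW)

theorem exists_flip (hd : ∀ i, (d i).2 < 0) (h𝒞 : IsTileComplex d W 𝒞) {U : List ι}
    (hgood : listEdges d 0 U ⊆ goodEdges d W 𝒞) (hend : labelSum d U = labelSum d W)
    (hne : U ≠ W) : ∃ V, U ≠ V ∧ WeakLE U V ∧ listEdges d 0 V ⊆ goodEdges d W 𝒞 := by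
  obtain ⟨C, hC, hleft, A, B, rfl, htop⟩ := h𝒞.exists_tile_along_of_ne hd hgood hend hne
  have hsum := labelSum_perm (d := d) (h𝒞.perm C hC)
  refine ⟨A ++ C.right ++ B, fun e => ?_,
    WeakLE.context (weakLE_of_pairwise_lt (h𝒞.sorted C hC) (h𝒞.perm C hC)) A B, ?_⟩
  · obtain ⟨x, X, hx⟩ := List.exists_cons_of_ne_nil hleft
    have hright : C.left = C.right := by simpa using e
    exact lt_irrefl x (h𝒞.head_lt C hC x X x X hx (hright ▸ hx))
  · simp only [listEdges_append, labelSum_append, zero_add, Set.union_subset_iff, ← htop,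
      ← hsum] at hgood ⊢
    exact ⟨⟨hgood.1.1, h𝒞.right_good C hC⟩, hgood.2⟩

theorem weakLE (hd : ∀ i, (d i).2 < 0) (h𝒞 : IsTileComplex d W 𝒞) {U : List ι}
    (hgood : listEdges d 0 U ⊆ goodEdges d W 𝒞) (hend : labelSum d U = labelSum d W) :
    WeakLE U W := by
  induction hm : U.length ^ 2 - invCount U using Nat.strong_induction_on generalizing U with
  | _ m ih =>
    rcases eq_or_ne U W with rfl | hne
    · exact .refl
    obtain ⟨V, hUV, hle, hV⟩ := h𝒞.exists_flip hd hgood hend hne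
    have hp := hle.perm
    have hlt := hle.invCount_lt hUV
    have hsq := invCount_le_sq V
    rw [← hp.length_eq] at hsq
    exact hle.trans (ih _ (by rw [← hp.length_eq]; omega) hV
      ((labelSum_perm hp).symm.trans hend) rfl)

theorem exists_good_edge_above (h𝒞 : IsTileComplex d W 𝒞) {v : ℝ × ℝ} (hv : v ≠ 0) {a : ι}
    (h : (v, a) ∈ goodEdges d W 𝒞) : ∃ v' a', (v', a') ∈ goodEdges d W 𝒞 ∧ v' + d a' = v := by
  -- The good edge from `v` with the largest label is not the first one on the left of a tile.
  obtain ⟨⟨_, a⟩, ⟨hgood, rfl⟩, hmax⟩ := Set.exists_max_image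
    {e | e ∈ goodEdges d W 𝒞 ∧ e.1 = v} Prod.snd (h𝒞.finite.subset fun e he => he.1)
    ⟨(v, a), h, rfl⟩
  have hgood' := hgood
  simp only [goodEdges, Set.mem_union, Set.mem_iUnion, exists_prop, mem_listEdges_iff] at hgood'
  rcases hgood' with ⟨A, B, hW, rfl⟩ | ⟨C, hC, A, B, hleft, rfl⟩
  · obtain ⟨A, a', rfl⟩ := (List.eq_nil_or_concat' A).resolve_left (by rintro rfl; simp at hv)
    exact ⟨labelSum d A, a', .inl (mem_listEdges_iff.2 ⟨A, a :: B, by simpa using hW, by simp⟩),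
      by simp⟩
  · rcases List.eq_nil_or_concat' A with rfl | ⟨A, a', rfl⟩
    · have hne : C.right ≠ [] := fun e => by simpa [hleft, e] using (h𝒞.perm C hC).length_eq
      obtain ⟨b, R, hright⟩ := List.exists_cons_of_ne_nil hne
      have hb : (C.top, b) ∈ goodEdges d W 𝒞 := h𝒞.right_good C hC (by simp [hright])
      exact absurd (hmax (C.top, b) ⟨hb, by simp⟩)
        (h𝒞.head_lt C hC a B b R hleft hright).not_ge
    · exact ⟨C.top + labelSum d A, a', .inr (Set.mem_biUnion hC
        (mem_listEdges_iff.2 ⟨A, a :: B, by simpa using hleft, rfl⟩)), by simp [add_assoc]⟩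

theorem exists_good_edge_below (h𝒞 : IsTileComplex d W 𝒞) {v : ℝ × ℝ} {a : ι}
    (h : (v, a) ∈ goodEdges d W 𝒞) (hv : v + d a ≠ labelSum d W) :
    ∃ a', (v + d a, a') ∈ goodEdges d W 𝒞 := by
  -- The good edge into `v + d a` with the smallest label is not the last one on the left of a tile.
  obtain ⟨⟨u, c⟩, ⟨hgood, hu⟩, hmin⟩ := Set.exists_min_image
    {e | e ∈ goodEdges d W 𝒞 ∧ e.1 + d e.2 = v + d a} Prod.snd
    (h𝒞.finite.subset fun e he => he.1) ⟨(v, a), h, rfl⟩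
  simp only at hu
  have hgood' := hgood
  simp only [goodEdges, Set.mem_union, Set.mem_iUnion, exists_prop, mem_listEdges_iff] at hgood'
  rw [← hu] at hmin hv ⊢
  rcases hgood' with ⟨A, B, hW, rfl⟩ | ⟨C, hC, A, B, hleft, rfl⟩
  · obtain ⟨a', B, rfl⟩ := List.exists_cons_of_ne_nil (l := B) (by rintro rfl; simp [hW] at hv)
    exact ⟨a', .inl (mem_listEdges_iff.2 ⟨A ++ [c], B, by simpa using hW, by simp⟩)⟩
  · rcases B with _ | ⟨a', B⟩
    · have hne : C.right ≠ [] := fun e => by simpa [hleft, e] using (h𝒞.perm C hC).length_eq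
      obtain ⟨R, b, hright⟩ := (List.eq_nil_or_concat' C.right).resolve_left hne
      have hb : (C.top + labelSum d R, b) ∈ goodEdges d W 𝒞 :=
        h𝒞.right_good C hC (mem_listEdges_iff.2 ⟨R, [], hright, rfl⟩)
      have hsum := labelSum_perm (d := d) (h𝒞.perm C hC)
      exact absurd (hmin _ ⟨hb, by simpa [hleft, hright, add_assoc] using hsum.symm⟩)
        (h𝒞.last_lt C hC c A b R hleft hright).not_ge
    · exact ⟨a', .inr (Set.mem_biUnion hC
        (mem_listEdges_iff.2 ⟨A ++ [c], B, by simpa using hleft, by simp [add_assoc]⟩))⟩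

theorem exists_path_above (hd : ∀ i, (d i).2 < 0) (h𝒞 : IsTileComplex d W 𝒞)
    {v : ℝ × ℝ} {a : ι} (h : (v, a) ∈ goodEdges d W 𝒞) :
    ∃ A, labelSum d A = v ∧ listEdges d 0 A ⊆ goodEdges d W 𝒞 := by
  by_contra hbad
  obtain ⟨⟨v, a⟩, ⟨hgood, hbad⟩, hmax⟩ := Set.exists_max_image
    {e | e ∈ goodEdges d W 𝒞 ∧ ¬ ∃ A, labelSum d A = e.1 ∧ listEdges d 0 A ⊆ goodEdges d W 𝒞}
    (fun e => e.1.2) (h𝒞.finite.subset fun e he => he.1) ⟨(v, a), h, hbad⟩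
  rcases eq_or_ne v 0 with rfl | hv
  · exact hbad ⟨[], by simp⟩
  obtain ⟨v', a', hgood', rfl⟩ := h𝒞.exists_good_edge_above hv hgood
  by_cases h' : ∃ A, labelSum d A = v' ∧ listEdges d 0 A ⊆ goodEdges d W 𝒞
  · obtain ⟨A, rfl, hA⟩ := h'
    refine hbad ⟨A ++ [a'], by simp, ?_⟩
    simpa [listEdges_append, Set.insert_subset_iff, hgood'] using hA
  · have := hmax (v', a') ⟨hgood', h'⟩
    simp only [Prod.snd_add] at this
    linarith [hd a']

theorem exists_path_below (hd : ∀ i, (d i).2 < 0) (h𝒞 : IsTileComplex d W 𝒞)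
    {v : ℝ × ℝ} {a : ι} (h : (v, a) ∈ goodEdges d W 𝒞) :
    ∃ B, v + d a + labelSum d B = labelSum d W ∧ listEdges d (v + d a) B ⊆ goodEdges d W 𝒞 := by
  by_contra hbad
  obtain ⟨⟨v, a⟩, ⟨hgood, hbad⟩, hmin⟩ := Set.exists_min_image
    {e | e ∈ goodEdges d W 𝒞 ∧ ¬ ∃ B, e.1 + d e.2 + labelSum d B = labelSum d W ∧
      listEdges d (e.1 + d e.2) B ⊆ goodEdges d W 𝒞}
    (fun e => e.1.2) (h𝒞.finite.subset fun e he => he.1) ⟨(v, a), h, hbad⟩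
  rcases eq_or_ne (v + d a) (labelSum d W) with hv | hv
  · exact hbad ⟨[], by simp [hv]⟩
  obtain ⟨a', hgood'⟩ := h𝒞.exists_good_edge_below hgood hv
  by_cases h' : ∃ B, v + d a + d a' + labelSum d B = labelSum d W ∧
      listEdges d (v + d a + d a') B ⊆ goodEdges d W 𝒞
  · obtain ⟨B, hB, hB'⟩ := h'
    exact hbad ⟨a' :: B, by simpa [add_assoc] using hB,
      by simpa [Set.insert_subset_iff, hgood'] using hB'⟩
  · have := hmin (v + d a, a') ⟨hgood', h'⟩
    simp only [Prod.snd_add] at this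
    linarith [hd a]

theorem exists_weakLE (hd : ∀ i, (d i).2 < 0) (h𝒞 : IsTileComplex d W 𝒞) {t : ℝ × ℝ}
    {R : List ι} (hR : R ≠ []) (hgood : listEdges d t R ⊆ goodEdges d W 𝒞) :
    ∃ A B, labelSum d A = t ∧ WeakLE (A ++ R ++ B) W := by
  obtain ⟨a, R', ha⟩ := List.exists_cons_of_ne_nil hR
  obtain ⟨R'', b, hb⟩ := (List.eq_nil_or_concat' R).resolve_left hR
  obtain ⟨A, hA, hAgood⟩ := h𝒞.exists_path_above hd (v := t) (a := a) (hgood (by simp [ha]))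
  obtain ⟨B, hB, hBgood⟩ :=
    h𝒞.exists_path_below hd (hgood (mem_listEdges_iff.2 ⟨R'', [], hb, rfl⟩))
  have hbottom : t + labelSum d R'' + d b = labelSum d (A ++ R) := by simp [hb, hA, add_assoc]
  rw [hbottom] at hB hBgood
  refine ⟨A, B, hA, h𝒞.weakLE hd ?_ (by rw [labelSum_append, hB])⟩
  simp only [listEdges_append, zero_add, hA, Set.union_subset_iff]
  exact ⟨⟨hAgood, hgood⟩, hBgood⟩

end IsTileComplex

end TileComplex

/-! ### The horizontal position along a descending path -/

section Position

variable {ι : Type*}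

/-- Edge vectors that point strictly downwards and turn counterclockwise as the label increases;
unlike in `IsEdgeSystem`, their lengths are arbitrary. -/
structure IsConvexEdgeSystem [LinearOrder ι] (d : ι → ℝ × ℝ) : Prop where
  down : ∀ i, (d i).2 < 0
  ccw : ∀ i j, i < j → 0 < (d i).1 * (d j).2 - (d i).2 * (d j).1

theorem IsEdgeSystem.isConvexEdgeSystem {n : ℕ} {d : Fin n → ℝ × ℝ} (hd : IsEdgeSystem d) :
    IsConvexEdgeSystem d :=
  ⟨hd.down, hd.ccw⟩

/-- The horizontal displacement per unit of depth along an edge. -/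
noncomputable def edgeSlope (d : ι → ℝ × ℝ) (a : ι) : ℝ :=
  (d a).1 / -(d a).2

/-- The height of the path with the labels `L`. -/
def depth (d : ι → ℝ × ℝ) (L : List ι) : ℝ :=
  -(labelSum d L).2

/-- The horizontal displacement at depth `s` along the path with the labels `L`; it is constant
above the path and below it. -/
noncomputable def xAt (d : ι → ℝ × ℝ) : List ι → ℝ → ℝ
  | [], _ => 0
  | a :: L, s => edgeSlope d a * max 0 (min s (-(d a).2)) + xAt d L (s + (d a).2)

variable {d : ι → ℝ × ℝ}

theorem IsConvexEdgeSystem.edgeSlope_lt [LinearOrder ι] (hd : IsConvexEdgeSystem d) {a b : ι}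
    (hab : a < b) : edgeSlope d a < edgeSlope d b := by
  rw [edgeSlope, edgeSlope, div_lt_div_iff₀ (neg_pos.2 (hd.down a)) (neg_pos.2 (hd.down b))]
  linarith [hd.ccw a b hab]

theorem edgeSlope_mul (hd : ∀ i, (d i).2 < 0) (a : ι) : edgeSlope d a * -(d a).2 = (d a).1 :=
  div_mul_cancel₀ _ (neg_pos.2 (hd a)).ne'

@[simp]
theorem depth_nil : depth d [] = 0 := by simp [depth]

@[simp]
theorem depth_cons (a : ι) (L : List ι) : depth d (a :: L) = -(d a).2 + depth d L := by
  simp [depth, add_comm]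

@[simp]
theorem depth_append (A B : List ι) : depth d (A ++ B) = depth d A + depth d B := by
  simp [depth, add_comm]

theorem depth_perm {L R : List ι} (h : L.Perm R) : depth d L = depth d R := by
  rw [depth, depth, labelSum_perm h]

theorem depth_nonneg (hd : ∀ i, (d i).2 < 0) (L : List ι) : 0 ≤ depth d L :=
  neg_nonneg.2 (labelSum_snd_nonpos hd L)

theorem depth_pos (hd : ∀ i, (d i).2 < 0) {L : List ι} (hL : L ≠ []) : 0 < depth d L :=
  neg_pos.2 (labelSum_snd_neg hd hL)

theorem continuous_xAt (L : List ι) : Continuous (xAt d L) := by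
  induction L with
  | nil => exact continuous_const
  | cons a L ih =>
    simp only [xAt]
    fun_prop

theorem xAt_of_nonpos (hd : ∀ i, (d i).2 < 0) (L : List ι) {s : ℝ} (hs : s ≤ 0) :
    xAt d L s = 0 := by
  induction L generalizing s with
  | nil => rfl
  | cons a L ih =>
    rw [xAt, max_eq_left (min_le_of_left_le hs), ih (by linarith [hd a]), mul_zero, add_zero]

theorem xAt_cons_of_le (hd : ∀ i, (d i).2 < 0) {a : ι} {L : List ι} {s : ℝ} (h0 : 0 ≤ s)
    (hs : s ≤ -(d a).2) : xAt d (a :: L) s = edgeSlope d a * s := by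
  rw [xAt, min_eq_left hs, max_eq_right h0, xAt_of_nonpos hd L (by linarith), add_zero]

theorem xAt_cons_of_ge (hd : ∀ i, (d i).2 < 0) {a : ι} {L : List ι} {s : ℝ}
    (hs : -(d a).2 ≤ s) : xAt d (a :: L) s = (d a).1 + xAt d L (s + (d a).2) := by
  rw [xAt, min_eq_right hs, max_eq_right (neg_pos.2 (hd a)).le, edgeSlope_mul hd]

theorem xAt_append (A B : List ι) (s : ℝ) :
    xAt d (A ++ B) s = xAt d A s + xAt d B (s - depth d A) := by
  induction A generalizing s with
  | nil => simp [xAt]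
  | cons a A ih =>
    simp only [List.cons_append, xAt, ih, depth_cons, add_assoc]
    ring_nf

theorem xAt_of_depth_le (hd : ∀ i, (d i).2 < 0) {L : List ι} {s : ℝ} (hs : depth d L ≤ s) :
    xAt d L s = (labelSum d L).1 := by
  induction L generalizing s with
  | nil => rfl
  | cons a L ih =>
    rw [depth_cons] at hs
    rw [xAt_cons_of_ge hd (by linarith [depth_nonneg hd L]), ih (by linarith), labelSum_cons,
      Prod.fst_add]

theorem xAt_append_depth (hd : ∀ i, (d i).2 < 0) (A B : List ι) :
    xAt d (A ++ B) (depth d A) = (labelSum d A).1 := by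
  rw [xAt_append, sub_self, xAt_of_nonpos hd B le_rfl, add_zero, xAt_of_depth_le hd le_rfl]

theorem xAt_context (hd : ∀ i, (d i).2 < 0) {A L : List ι} (B : List ι) {s : ℝ}
    (h0 : depth d A ≤ s) (h1 : s ≤ depth d A + depth d L) :
    xAt d (A ++ L ++ B) s = (labelSum d A).1 + xAt d L (s - depth d A) := by
  rw [xAt_append, xAt_append, xAt_of_depth_le hd h0,
    xAt_of_nonpos hd B (by rw [depth_append]; linarith), add_zero]

theorem xAt_swap_sub (hd : ∀ i, (d i).2 < 0) (a b : ι) (B : List ι) (s : ℝ) :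
    xAt d (b :: a :: B) s - xAt d (a :: b :: B) s = (edgeSlope d b - edgeSlope d a) *
      (max 0 (min s (-(d b).2)) - max 0 (min (s + (d a).2) (-(d b).2))) := by
  have ha := hd a
  have hb := hd b
  have hcover : max 0 (min s (-(d a).2)) + max 0 (min (s + (d a).2) (-(d b).2)) =
      max 0 (min s (-(d b).2)) + max 0 (min (s + (d b).2) (-(d a).2)) := by
    simp only [max_def, min_def]
    split_ifs <;> linarith
  have hrest : s + (d a).2 + (d b).2 = s + (d b).2 + (d a).2 := by ring
  simp only [xAt, hrest]
  linear_combination -edgeSlope d a * hcover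

variable [LinearOrder ι]

theorem SwapStep.xAt_le (hd : IsConvexEdgeSystem d) {U V : List ι} (h : SwapStep U V) (s : ℝ) :
    xAt d U s ≤ xAt d V s := by
  obtain ⟨A, B, a, b, hab, rfl, rfl⟩ := h
  rw [xAt_append, xAt_append]
  have hslope := sub_nonneg.2 (hd.edgeSlope_lt hab).le
  have hmono : max 0 (min (s - depth d A + (d a).2) (-(d b).2)) ≤
      max 0 (min (s - depth d A) (-(d b).2)) :=
    max_le_max le_rfl (min_le_min (by linarith [hd.down a]) le_rfl)
  linarith [xAt_swap_sub hd.down a b B (s - depth d A),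
    mul_nonneg hslope (sub_nonneg.2 hmono)]

theorem WeakLE.xAt_le (hd : IsConvexEdgeSystem d) {U V : List ι} (h : WeakLE U V) (s : ℝ) :
    xAt d U s ≤ xAt d V s := by
  induction h with
  | refl => exact le_rfl
  | tail _ h ih => exact ih.trans (h.xAt_le hd s)

theorem xAt_swap_lt (hd : IsConvexEdgeSystem d) {a b : ι} (hab : a < b) (A B : List ι) {s : ℝ}
    (h0 : depth d A < s) (h1 : s < depth d (A ++ [a, b])) :
    xAt d (A ++ a :: b :: B) s < xAt d (A ++ b :: a :: B) s := by
  rw [xAt_append, xAt_append]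
  simp only [depth_append, depth_cons, depth_nil] at h1
  have hslope := sub_pos.2 (hd.edgeSlope_lt hab)
  have hb := hd.down b
  have hlt : max 0 (min (s - depth d A + (d a).2) (-(d b).2)) <
      max 0 (min (s - depth d A) (-(d b).2)) := by
    refine lt_max_of_lt_right (max_lt (lt_min ?_ ?_) (lt_min ?_ ?_)) <;>
    first | linarith | exact min_lt_of_left_lt (by linarith [hd.down a])
  linarith [xAt_swap_sub hd.down a b B (s - depth d A), mul_pos hslope (sub_pos.2 hlt)]

/-- The path moves strictly to the right at a vertex as soon as a swap changes that vertex. -/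
theorem WeakLE.exists_perm_prefix (hd : IsConvexEdgeSystem d) {A B V : List ι}
    (h : WeakLE (A ++ B) V) (hle : xAt d V (depth d A) ≤ xAt d (A ++ B) (depth d A)) :
    ∃ A' B', V = A' ++ B' ∧ A'.Perm A := by
  induction h with
  | refl => exact ⟨A, B, rfl, .refl A⟩
  | @tail U V hU hstep ih =>
    obtain ⟨A', B', hA'B', hperm⟩ := ih ((hstep.xAt_le hd _).trans hle)
    have hno := hle.trans (WeakLE.xAt_le hd hU _)
    obtain ⟨C, D, a, b, hab, rfl, rfl⟩ := hstep
    rcases List.append_eq_append_iff.1 hA'B' with ⟨E, rfl, hE⟩ | ⟨E, rfl, -⟩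
    · rcases E with _ | ⟨x, _ | ⟨y, E⟩⟩
      · exact ⟨C, b :: a :: D, rfl, by simpa using hperm⟩
      · obtain ⟨rfl, -⟩ : a = x ∧ b :: D = B' := by simpa using hE
        refine absurd hno (xAt_swap_lt hd hab C D ?_ ?_).not_ge <;>
          simp only [← depth_perm hperm, depth_append, depth_cons, depth_nil] <;>
          linarith [hd.down a, hd.down b]
      · obtain ⟨rfl, rfl, rfl⟩ : a = x ∧ b = y ∧ D = E ++ B' := by simpa using hE
        exact ⟨C ++ b :: a :: E, B', by simp, (((List.Perm.swap a b E).append_left C)).trans hperm⟩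
    · exact ⟨A', E ++ b :: a :: D, by simp, hperm⟩

end Position

/-! ### The region of an Elnitsky polygon in coordinates -/

section Region

open Filter Topology

section Trace

variable {ι : Type*} {d : ι → ℝ × ℝ}

theorem mem_segment_edge_iff (hd : ∀ i, (d i).2 < 0) (t : ℝ × ℝ) (a : ι) (z : ℝ × ℝ) :
    z ∈ segment ℝ t (t + d a) ↔ 0 ≤ t.2 - z.2 ∧ t.2 - z.2 ≤ -(d a).2 ∧
      z.1 = t.1 + edgeSlope d a * (t.2 - z.2) := by
  have ha := neg_pos.2 (hd a)
  have hs := edgeSlope_mul hd a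
  rw [segment_eq_image']
  constructor
  · rintro ⟨θ, ⟨h0, h1⟩, rfl⟩
    have hheight : t.2 - (t + θ • (t + d a - t)).2 = θ * -(d a).2 := by simp
    rw [hheight]
    refine ⟨mul_nonneg h0 ha.le, mul_le_of_le_one_left ha.le h1, ?_⟩
    simp only [add_sub_cancel_left, Prod.fst_add, Prod.smul_fst, smul_eq_mul]
    linear_combination -θ * hs
  · rintro ⟨h0, h1, h3⟩
    have hθ : (t.2 - z.2) / -(d a).2 * -(d a).2 = t.2 - z.2 := div_mul_cancel₀ _ ha.ne'
    refine ⟨(t.2 - z.2) / -(d a).2, ⟨div_nonneg h0 ha.le, (div_le_one ha).2 h1⟩,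
      Prod.ext ?_ ?_⟩ <;>
      simp only [add_sub_cancel_left, Prod.fst_add, Prod.smul_fst, Prod.snd_add, Prod.smul_snd,
        smul_eq_mul]
    · linear_combination -h3 + edgeSlope d a * hθ - (t.2 - z.2) / -(d a).2 * hs
    · linear_combination -hθ

/-- The points of the path from `t` with the labels `L`. -/
def listTrace (d : ι → ℝ × ℝ) (t : ℝ × ℝ) (L : List ι) : Set (ℝ × ℝ) :=
  {t} ∪ ⋃ e ∈ listEdges d t L, segment ℝ e.1 (e.1 + d e.2)

theorem listTrace_cons (t : ℝ × ℝ) (a : ι) (L : List ι) :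
    listTrace d t (a :: L) = segment ℝ t (t + d a) ∪ listTrace d (t + d a) L := by
  rw [listTrace, listTrace, listEdges_cons, Set.biUnion_insert, ← Set.union_assoc,
    ← Set.union_assoc, Set.singleton_union, Set.union_singleton,
    Set.insert_eq_self.2 (left_mem_segment _ _ _), Set.insert_eq_self.2 (right_mem_segment _ _ _)]

theorem mem_listTrace_iff (hd : ∀ i, (d i).2 < 0) (t : ℝ × ℝ) (L : List ι) (z : ℝ × ℝ) :
    z ∈ listTrace d t L ↔
      0 ≤ t.2 - z.2 ∧ t.2 - z.2 ≤ depth d L ∧ z.1 = t.1 + xAt d L (t.2 - z.2) := by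
  induction L generalizing t with
  | nil =>
    simp only [listTrace, listEdges_nil, Set.mem_empty_iff_false, Set.iUnion_of_empty,
      Set.iUnion_empty, Set.union_empty, Set.mem_singleton_iff, depth_nil, xAt, add_zero,
      Prod.ext_iff, sub_nonneg, sub_nonpos]
    grind
  | cons a L ih =>
    have ha := hd a
    have hL := depth_nonneg hd L
    rw [listTrace_cons, Set.mem_union, ih, mem_segment_edge_iff hd, Prod.snd_add, Prod.fst_add,
      depth_cons, add_sub_right_comm]
    generalize t.2 - z.2 = s
    constructor
    · rintro (⟨h0, h1, hx⟩ | ⟨h0, h1, hx⟩)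
      · exact ⟨h0, by linarith, by rw [xAt_cons_of_le hd h0 h1, hx]⟩
      · exact ⟨by linarith, by linarith, by
          rw [xAt_cons_of_ge hd (by linarith), hx, add_assoc]⟩
    · rintro ⟨h0, h1, hx⟩
      rcases le_total s (-(d a).2) with h | h
      · exact .inl ⟨h0, h, by rw [hx, xAt_cons_of_le hd h0 h]⟩
      · exact .inr ⟨by linarith, by linarith, by rw [hx, xAt_cons_of_ge hd h, add_assoc]⟩

/-- The points between the paths `U` and `W` from the vertex `t`, which are meant to have the same
depth. -/
def between (d : ι → ℝ × ℝ) (t : ℝ × ℝ) (U W : List ι) : Set (ℝ × ℝ) :=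
  {z | 0 ≤ t.2 - z.2 ∧ t.2 - z.2 ≤ depth d U ∧ t.1 + xAt d U (t.2 - z.2) ≤ z.1 ∧
    z.1 ≤ t.1 + xAt d W (t.2 - z.2)}

theorem mem_between_zero {U W : List ι} {z : ℝ × ℝ} : z ∈ between d 0 U W ↔
    0 ≤ -z.2 ∧ -z.2 ≤ depth d U ∧ xAt d U (-z.2) ≤ z.1 ∧ z.1 ≤ xAt d W (-z.2) := by
  simp only [between, Set.mem_ofPred_eq, Prod.fst_zero, Prod.snd_zero, zero_sub, zero_add]

theorem lt_of_mem_interior_between {t z : ℝ × ℝ} {U W : List ι}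
    (hz : z ∈ interior (between d t U W)) :
    t.1 + xAt d U (t.2 - z.2) < z.1 ∧ z.1 < t.1 + xAt d W (t.2 - z.2) := by
  have hshift : Tendsto (fun x : ℝ => (x, z.2)) (𝓝 z.1) (𝓝 z) :=
    (Continuous.prodMk_left z.2).tendsto z.1
  have hnear : ∀ᶠ x in 𝓝 z.1, (x, z.2) ∈ between d t U W :=
    hshift (mem_interior_iff_mem_nhds.1 hz)
  obtain ⟨x, hx, hxz⟩ :=
    ((hnear.filter_mono nhdsWithin_le_nhds).and (self_mem_nhdsWithin (s := Set.Iio z.1))).exists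
  obtain ⟨y, hy, hyz⟩ :=
    ((hnear.filter_mono nhdsWithin_le_nhds).and (self_mem_nhdsWithin (s := Set.Ioi z.1))).exists
  exact ⟨hx.2.2.1.trans_lt hxz, hyz.trans_le hy.2.2.2⟩

theorem mem_interior_between {t z : ℝ × ℝ} {U W : List ι}
    (h0 : 0 < t.2 - z.2) (h1 : t.2 - z.2 < depth d U) (h2 : t.1 + xAt d U (t.2 - z.2) < z.1)
    (h3 : z.1 < t.1 + xAt d W (t.2 - z.2)) : z ∈ interior (between d t U W) := by
  have hx (L : List ι) : Continuous fun z : ℝ × ℝ => t.1 + xAt d L (t.2 - z.2) :=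
    continuous_const.add ((continuous_xAt L).comp (by fun_prop))
  rw [mem_interior_iff_mem_nhds]
  have hs : ContinuousAt (fun z : ℝ × ℝ => t.2 - z.2) z := by fun_prop
  filter_upwards [continuousAt_const.eventually_lt hs h0, hs.eventually_lt continuousAt_const h1,
    (hx U).continuousAt.eventually_lt continuousAt_fst h2,
    continuousAt_fst.eventually_lt (hx W).continuousAt h3] with y h0 h1 h2 h3
  exact ⟨h0.le, h1.le, h2.le, h3.le⟩

end Trace

variable {n : ℕ} {d : Fin n → ℝ × ℝ}

theorem pathVertex_succ {k : ℕ} (t : ℝ × ℝ) (f : Fin (k + 1) → Fin n) (j : ℕ) :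
    pathVertex d t f (j + 1) = pathVertex d (t + d (f 0)) (fun i => f i.succ) j := by
  simp only [pathVertex, Finset.sum_filter, Fin.sum_univ_succ, Fin.val_zero, Fin.val_succ,
    Nat.zero_lt_succ, if_true, Nat.add_lt_add_iff_right, add_assoc]

theorem pathEdges_eq_listEdges {k : ℕ} (t : ℝ × ℝ) (f : Fin k → Fin n) :
    pathEdges d t f = listEdges d t (List.ofFn f) := by
  induction k generalizing t with
  | zero => simp [pathEdges]
  | succ k ih =>
    rw [List.ofFn_succ, listEdges_cons, ← ih, pathEdges, ← Fin.cons_self_tail fun m =>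
      (pathVertex d t f m, f m), Fin.range_cons]
    simp only [Fin.tail_def, Fin.val_succ, pathVertex_succ]
    simp [pathEdges, pathVertex]

theorem mem_pathTrace_iff (hd : ∀ i, (d i).2 < 0) {k : ℕ} (t : ℝ × ℝ) (f : Fin k → Fin n)
    (z : ℝ × ℝ) : z ∈ pathTrace d t f ↔ 0 ≤ t.2 - z.2 ∧ t.2 - z.2 ≤ depth d (List.ofFn f) ∧
      z.1 = t.1 + xAt d (List.ofFn f) (t.2 - z.2) := by
  rw [pathTrace, pathEdges_eq_listEdges]
  exact mem_listTrace_iff hd t _ z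

namespace ElnitskyPolygon

/-- The labels of the left half from top to bottom. -/
def leftList (P : ElnitskyPolygon n) : List (Fin n) :=
  List.ofFn P.label

/-- The labels of the right half from top to bottom. -/
def rightList (P : ElnitskyPolygon n) : List (Fin n) :=
  List.ofFn fun i => P.label (P.perm i)

variable (P : ElnitskyPolygon n)

theorem leftList_sorted : P.leftList.Pairwise (· < ·) :=
  List.pairwise_ofFn.2 fun _ _ h => P.label.strictMono h

theorem leftList_perm : P.leftList.Perm P.rightList :=
  (Equiv.Perm.ofFn_comp_perm P.perm P.label).symm

theorem weakLE : WeakLE P.leftList P.rightList :=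
  weakLE_of_pairwise_lt P.leftList_sorted P.leftList_perm

theorem leftEdges_eq : P.leftEdges d = listEdges d P.top P.leftList :=
  pathEdges_eq_listEdges _ _

theorem rightEdges_eq : P.rightEdges d = listEdges d P.top P.rightList :=
  pathEdges_eq_listEdges _ _

theorem region_eq (hd : ∀ i, (d i).2 < 0) :
    P.region d = between d P.top P.leftList P.rightList := by
  have hdepth : depth d P.leftList = depth d P.rightList := depth_perm P.leftList_perm
  ext z
  simp only [region, Set.mem_ofPred_eq, mem_pathTrace_iff hd, between]
  constructor
  · rintro ⟨l, ⟨hl0, hl1, hl2⟩, r, ⟨-, -, hr2⟩, hlz, hrz, h1, h2⟩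
    rw [hlz] at hl0 hl1 hl2
    rw [hrz] at hr2
    exact ⟨hl0, hl1, hl2 ▸ h1, hr2 ▸ h2⟩
  · rintro ⟨h0, h1, h2, h3⟩
    exact ⟨(P.top.1 + xAt d P.leftList (P.top.2 - z.2), z.2), ⟨h0, h1, rfl⟩,
      (P.top.1 + xAt d P.rightList (P.top.2 - z.2), z.2), ⟨h0, hdepth ▸ h1, rfl⟩, rfl, rfl, h2, h3⟩

theorem region_X (hd : ∀ i, (d i).2 < 0) (w : Equiv.Perm (Fin n)) :
    (X w).region d = between d 0 (List.ofFn (1 : Equiv.Perm (Fin n))) (List.ofFn w) :=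
  region_eq _ hd

theorem eventually_mem_interior_right_of_left (hd : IsConvexEdgeSystem d) {A B : List (Fin n)}
    (hL : P.leftList = A ++ B) (hA : A ≠ []) (hB : B ≠ [])
    (hR : ∀ A' B', P.rightList = A' ++ B' → ¬ A'.Perm A) :
    ∀ᶠ δ in 𝓝[>] (0 : ℝ), P.top + labelSum d A + (δ, 0) ∈ interior (P.region d) := by
  have hle : WeakLE (A ++ B) P.rightList := hL ▸ P.weakLE
  have hlt : xAt d (A ++ B) (depth d A) < xAt d P.rightList (depth d A) := by
    by_contra! h
    obtain ⟨A', B', hA'B', hperm⟩ := hle.exists_perm_prefix hd h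
    exact hR A' B' hA'B' hperm
  rw [xAt_append_depth hd.down] at hlt
  filter_upwards [Ioo_mem_nhdsGT (sub_pos.2 hlt)] with δ hδ
  have hs : P.top.2 - (P.top + labelSum d A + (δ, 0)).2 = depth d A := by simp [depth]
  rw [region_eq P hd.down, hL]
  apply mem_interior_between <;> rw [hs]
  · exact depth_pos hd.down hA
  · linarith [depth_append (d := d) A B, depth_pos hd.down hB]
  · rw [xAt_append_depth hd.down]
    simpa using hδ.1
  · simpa [add_assoc] using lt_sub_iff_add_lt'.1 hδ.2

theorem eventually_mem_interior_left_of_right (hd : IsConvexEdgeSystem d) {A B : List (Fin n)}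
    {a b : Fin n} (hR : P.rightList = A ++ b :: a :: B) (hab : a < b) :
    ∀ᶠ δ in 𝓝[>] (0 : ℝ), P.top + labelSum d (A ++ [b]) - (δ, 0) ∈ interior (P.region d) := by
  have hdepth : depth d P.leftList = depth d (A ++ [b] ++ a :: B) := by
    simpa [hR] using depth_perm (d := d) P.leftList_perm
  have hle : WeakLE P.leftList (A ++ a :: b :: B) := weakLE_of_pairwise_lt P.leftList_sorted
    (P.leftList_perm.trans (hR ▸ (List.Perm.swap a b B).append_left A))
  have hlt : xAt d P.leftList (depth d (A ++ [b])) < xAt d P.rightList (depth d (A ++ [b])) := by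
    rw [hR]
    refine (hle.xAt_le hd _).trans_lt (xAt_swap_lt hd hab A B ?_ ?_) <;>
      simp only [depth_append, depth_cons, depth_nil] <;> linarith [hd.down a, hd.down b]
  have hright : xAt d P.rightList (depth d (A ++ [b])) = (labelSum d (A ++ [b])).1 := by
    rw [hR, ← xAt_append_depth hd.down (A ++ [b]) (a :: B), List.append_assoc,
      List.singleton_append]
  filter_upwards [Ioo_mem_nhdsGT (sub_pos.2 hlt)] with δ hδ
  have hs : P.top.2 - (P.top + labelSum d (A ++ [b]) - (δ, 0)).2 = depth d (A ++ [b]) := by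
    simp [depth]
  rw [region_eq P hd.down]
  apply mem_interior_between <;> rw [hs]
  · exact depth_pos hd.down (by simp)
  · rw [hdepth, depth_append (A ++ [b])]
    linarith [depth_pos hd.down (List.cons_ne_nil a B)]
  · rw [Prod.fst_sub, Prod.fst_add]
    linarith [hδ.2, hright]
  · rw [Prod.fst_sub, Prod.fst_add, hright]
    linarith [hδ.1]

end ElnitskyPolygon

end Region

/-! ### Components of a paw and edge paths in a paw tiling -/

section Components

/-- The two sides `L` and `R` of a polygon enclose between them a component with the sides `M` and
`N`, which meet only at their ends. Above it the sides are `A` and `A'`, below it `B` and `B'`. A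
common vertex of the two sides is recorded as a pair of prefixes that are rearrangements of each
other. -/
structure IsComponent {α : Type*} (L R A M B A' N B' : List α) : Prop where
  left_eq : L = A ++ M ++ B
  right_eq : R = A' ++ N ++ B'
  perm_above : A.Perm A'
  perm : M.Perm N
  unpinched : ∀ X Y X' Y', M = X ++ Y → N = X' ++ Y' → X.Perm X' → X = [] ∨ Y = []

namespace IsComponent

variable {α : Type*} {L R A M B A' N B' : List α}

theorem eq_nil_or_of_perm_append (h : IsComponent L R A M B A' N B') {X Y R₁ R₂ : List α}
    (hM : M = X ++ Y) (hR : R = R₁ ++ R₂) (hp : R₁.Perm (A ++ X)) : X = [] ∨ Y = [] := by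
  have hlen := hp.length_eq
  have hlenA := h.perm_above.length_eq
  have hlenM := h.perm.length_eq
  simp only [hM, List.length_append] at hlen hlenM
  obtain ⟨X', rfl⟩ : A' <+: R₁ :=
    List.prefix_of_prefix_length_le ⟨N ++ B', by rw [h.right_eq, List.append_assoc]⟩ ⟨R₂, hR.symm⟩
      (by omega)
  have hN : N ++ B' = X' ++ R₂ := by simpa [hR] using h.right_eq.symm
  rw [List.length_append] at hlen
  obtain ⟨Y', rfl⟩ : X' <+: N :=
    List.prefix_of_prefix_length_le ⟨R₂, hN.symm⟩ (List.prefix_append N B') (by omega)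
  exact h.unpinched X Y X' Y' hM rfl
    ((List.perm_append_left_iff A').1 (hp.trans (h.perm_above.append_right X))).symm

theorem append (h : IsComponent L R A M B A' N B') {X Y X' Y' : List α} (hX : X.Perm X') :
    IsComponent (X ++ L ++ Y) (X' ++ R ++ Y') (X ++ A) M (B ++ Y) (X' ++ A') N (B' ++ Y') where
  left_eq := by simp [h.left_eq]
  right_eq := by simp [h.right_eq]
  perm_above := hX.append h.perm_above
  perm := h.perm
  unpinched := h.unpinched

variable [LinearOrder α]

theorem left_sorted (h : IsComponent L R A M B A' N B') (hL : L.Pairwise (· < ·)) :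
    M.Pairwise (· < ·) :=
  hL.sublist (h.left_eq ▸ (List.infix_append A M B).sublist)

theorem head_lt (h : IsComponent L R A M B A' N B') (hL : L.Pairwise (· < ·)) (hMN : M ≠ N)
    {a b : α} {X Y : List α} (hM : M = a :: X) (hN : N = b :: Y) : a < b := by
  have hsorted := h.left_sorted hL
  have hperm := h.perm
  rw [hM, List.pairwise_cons] at hsorted
  rw [hM, hN] at hperm hMN
  rcases List.mem_cons.1 (hperm.symm.subset List.mem_cons_self) with rfl | hb
  · rcases h.unpinched [b] X [b] Y hM hN (.refl _) with hnil | rfl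
    · simp at hnil
    · exact absurd (List.perm_singleton.1 hperm.symm).symm hMN
  · exact hsorted.1 b hb

theorem last_lt (h : IsComponent L R A M B A' N B') (hL : L.Pairwise (· < ·)) (hMN : M ≠ N)
    {a b : α} {X Y : List α} (hM : M = X ++ [a]) (hN : N = Y ++ [b]) : b < a := by
  have hsorted := h.left_sorted hL
  have hperm := h.perm
  rw [hM, List.pairwise_append] at hsorted
  rw [hM, hN] at hperm hMN
  rcases List.mem_append.1 (hperm.symm.subset List.mem_concat_self) with hb | hb
  · exact hsorted.2.2 b hb a (List.mem_singleton_self a)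
  · obtain rfl := List.mem_singleton.1 hb
    rw [List.perm_append_right_iff] at hperm
    rcases h.unpinched X [b] Y [b] hM hN hperm with rfl | hnil
    · exact absurd (by rw [List.nil_perm.1 hperm]) hMN
    · simp at hnil

end IsComponent

theorem exists_component {ι : Type*} {d : ι → ℝ × ℝ} {t : ℝ × ℝ} {L R : List ι} (hp : L.Perm R)
    {e : (ℝ × ℝ) × ι} (he : e ∈ listEdges d t L) (he' : e ∉ listEdges d t R) :
    ∃ A M B A' N B', IsComponent L R A M B A' N B' ∧ e ∈ listEdges d (t + labelSum d A) M ∧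
      e ∉ listEdges d (t + labelSum d A) N := by
  induction hm : L.length using Nat.strong_induction_on generalizing t L R with
  | _ m ih =>
    by_cases h : ∀ X Y X' Y', L = X ++ Y → R = X' ++ Y' → X.Perm X' → X = [] ∨ Y = []
    · exact ⟨[], L, [], [], R, [], ⟨by simp, by simp, .refl _, hp, h⟩, by simpa using he,
        by simpa using he'⟩
    push Not at h
    obtain ⟨X, Y, X', Y', rfl, rfl, hX, hXne, hYne⟩ := h
    have hY : Y.Perm Y' := (List.perm_append_left_iff X).1 (hp.trans (hX.symm.append_right Y'))
    have hlenX := List.length_pos_iff.2 hXne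
    have hlenY := List.length_pos_iff.2 hYne
    rw [List.length_append] at hm
    rw [listEdges_append] at he he'
    rw [Set.mem_union, not_or, ← labelSum_perm hX] at he'
    rcases he with he | he
    · obtain ⟨A, M, B, A', N, B', hc, heM, heN⟩ := ih X.length (by omega) hX he he'.1 rfl
      exact ⟨A, M, B ++ Y, A', N, B' ++ Y', hc.append (X := []) (X' := []) (.refl _), heM, heN⟩
    · obtain ⟨A, M, B, A', N, B', hc, heM, heN⟩ := ih Y.length (by omega) hY he he'.2 rfl
      rw [add_assoc, ← labelSum_append] at heM heN
      exact ⟨X ++ A, M, B, X' ++ A', N, B',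
        by simpa using hc.append (Y := []) (Y' := []) hX, heM, heN⟩

open ElnitskyPolygon

variable {n : ℕ} {d : Fin n → ℝ × ℝ} {w : Equiv.Perm (Fin n)} {T : Set (ElnitskyPolygon n)}

/-- The nondegenerate components of the tiles in `T`. -/
def tileComponents (d : Fin n → ℝ × ℝ) (T : Set (ElnitskyPolygon n)) : Set (ListTile (Fin n)) :=
  {C | C.left ≠ C.right ∧ ∃ P ∈ T, ∃ A B A' B',
    IsComponent P.leftList P.rightList A C.left B A' C.right B' ∧ C.top = P.top + labelSum d A}

theorem exists_tileComponent {P : ElnitskyPolygon n} (hP : P ∈ T) {e : (ℝ × ℝ) × Fin n}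
    (he : e ∈ P.leftEdges d) (he' : e ∉ P.rightEdges d) :
    ∃ C ∈ tileComponents d T, e ∈ listEdges d C.top C.left := by
  rw [leftEdges_eq] at he
  rw [rightEdges_eq] at he'
  obtain ⟨A, M, B, A', N, B', hc, heM, heN⟩ := exists_component P.leftList_perm he he'
  exact ⟨⟨P.top + labelSum d A, M, N⟩,
    ⟨fun hMN : M = N => heN (hMN ▸ heM), P, hP, A, B, A', B', hc, rfl⟩, heM⟩

open Filter Topology in
theorem IsComponent.eventually_mem_interior (hd : IsConvexEdgeSystem d) {P : ElnitskyPolygon n}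
    {A M B A' N B' X Y : List (Fin n)} (h : IsComponent P.leftList P.rightList A M B A' N B')
    (hM : M = X ++ Y) (hX : X ≠ []) (hY : Y ≠ []) :
    ∀ᶠ δ in 𝓝[>] (0 : ℝ),
      P.top + labelSum d A + labelSum d X + (δ, 0) ∈ interior (P.region d) := by
  rw [add_assoc, ← labelSum_append]
  refine P.eventually_mem_interior_right_of_left hd (B := Y ++ B) (by simp [h.left_eq, hM])
    (by simp [hX]) (by simp [hY]) fun R₁ R₂ hR hp => ?_
  exact (h.eq_nil_or_of_perm_append hM hR hp).elim hX hY

namespace IsPawTiling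

theorem rightEdges_subset_goodEdges (hT : IsPawTiling d w T) {P : ElnitskyPolygon n}
    (hP : P ∈ T) : P.rightEdges d ⊆ goodEdges d (List.ofFn w) (tileComponents d T) := by
  intro e he
  rcases hT.right_edge P hP e he with h | ⟨Q, hQ, hleft, hright⟩
  · exact .inl (rightEdges_eq (d := d) (X w) ▸ h)
  · obtain ⟨C, hC, heC⟩ := exists_tileComponent hQ hleft hright
    exact .inr (Set.mem_biUnion hC heC)

theorem finite_goodEdges (hT : IsPawTiling d w T) :
    (goodEdges d (List.ofFn w) (tileComponents d T)).Finite := by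
  have hfin : ((X w).rightEdges d ∪ ⋃ P ∈ T, P.leftEdges d).Finite :=
    (Set.finite_range _).union (hT.finite.biUnion fun P _ => Set.finite_range _)
  refine hfin.subset (Set.union_subset_union ?_ (Set.iUnion₂_subset ?_))
  · rw [rightEdges_eq]
    exact subset_rfl
  · rintro C ⟨-, P, hP, A, B, A', B', hc, htop⟩ e he
    refine Set.mem_biUnion hP ?_
    rw [leftEdges_eq, hc.left_eq, listEdges_append, listEdges_append, ← htop]
    exact .inl (.inr he)

/-- Two components with a common inner vertex on their left sides overlap next to it, so they belong
to the same tile. -/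
theorem next_eq_of_vertex_eq (hd : IsConvexEdgeSystem d) (hT : IsPawTiling d w T)
    {C C' : ListTile (Fin n)} (hC : C ∈ tileComponents d T) (hC' : C' ∈ tileComponents d T)
    {X Y X' Y' : List (Fin n)} {a a' : Fin n} (hX : X ≠ []) (hX' : X' ≠ [])
    (hleft : C.left = X ++ a :: Y) (hleft' : C'.left = X' ++ a' :: Y')
    (hv : C.top + labelSum d X = C'.top + labelSum d X') : a = a' := by
  obtain ⟨-, P, hP, A, B, _, _, hc, htop⟩ := hC
  obtain ⟨-, P', hP', A', B', _, _, hc', htop'⟩ := hC'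
  have hint := hc.eventually_mem_interior hd hleft hX (List.cons_ne_nil a Y)
  have hint' := hc'.eventually_mem_interior hd hleft' hX' (List.cons_ne_nil a' Y')
  rw [← htop] at hint
  rw [← htop', ← hv] at hint'
  obtain ⟨δ, hδ, hδ'⟩ := (hint.and hint').exists
  obtain rfl : P = P' := by
    by_contra hne
    exact Set.disjoint_left.1 (hT.no_overlap P hP P' hP' hne) hδ (interior_subset hδ')
  have hlist : A ++ X ++ a :: (Y ++ B) = A' ++ X' ++ a' :: (Y' ++ B') := by
    simpa [hleft, hleft'] using hc.left_eq.symm.trans hc'.left_eq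
  rw [htop, htop', add_assoc, add_assoc, add_right_inj, ← labelSum_append,
    ← labelSum_append] at hv
  exact (List.cons.inj (append_inj_of_labelSum_snd hd.down hlist (by rw [hv])).2).1

theorem vertex_ne_border (hd : IsConvexEdgeSystem d) (hT : IsPawTiling d w T)
    {C : ListTile (Fin n)} (hC : C ∈ tileComponents d T) {X Y X' Y' : List (Fin n)}
    (hX : X ≠ []) (hY : Y ≠ []) (hleft : C.left = X ++ Y) (hw : List.ofFn w = X' ++ Y') :
    C.top + labelSum d X ≠ labelSum d X' := by
  intro hv
  obtain ⟨-, P, hP, A, B, _, _, hc, htop⟩ := hC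
  obtain ⟨δ, hδ, hδpos⟩ := ((hc.eventually_mem_interior hd hleft hX hY).and
    self_mem_nhdsWithin).exists
  have hmem := (hT.inside P hP (interior_subset hδ))
  rw [← htop, hv, region_X hd.down, hw] at hmem
  have hs : (0 : ℝ × ℝ).2 - (labelSum d X' + (δ, 0)).2 = depth d X' := by simp [depth]
  have hle := hmem.2.2.2
  rw [hs, xAt_append_depth hd.down] at hle
  exact absurd hδpos (by simpa using hle)

theorem isTileComplex (hd : IsConvexEdgeSystem d) (hT : IsPawTiling d w T) :
    IsTileComplex d (List.ofFn w) (tileComponents d T) where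
  finite := hT.finite_goodEdges
  sorted := by
    rintro C ⟨-, P, -, A, B, A', B', hc, -⟩
    exact hc.left_sorted P.leftList_sorted
  perm := by
    rintro C ⟨-, P, -, A, B, A', B', hc, -⟩
    exact hc.perm
  head_lt := by
    rintro C ⟨hne, P, -, A, B, A', B', hc, -⟩ a X b Y
    exact hc.head_lt P.leftList_sorted hne
  last_lt := by
    rintro C ⟨hne, P, -, A, B, A', B', hc, -⟩ a X b Y
    exact hc.last_lt P.leftList_sorted hne
  next_eq C hC C' hC' A a B A' a' B' := hT.next_eq_of_vertex_eq hd hC hC'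
  not_border C hC A B A' B' := hT.vertex_ne_border hd hC
  right_good := by
    rintro C ⟨-, P, hP, A, B, A', B', hc, htop⟩ e he
    refine hT.rightEdges_subset_goodEdges hP ?_
    rw [rightEdges_eq, hc.right_eq, listEdges_append, listEdges_append,
      ← labelSum_perm hc.perm_above, ← htop]
    exact .inl (.inr he)

theorem exists_weakLE (hd : IsConvexEdgeSystem d) (hT : IsPawTiling d w T)
    {P : ElnitskyPolygon n} (hP : P ∈ T) (hne : P.rightList ≠ []) :
    ∃ A B, labelSum d A = P.top ∧ WeakLE (A ++ P.rightList ++ B) (List.ofFn w) :=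
  (hT.isTileComplex hd).exists_weakLE hd.down hne
    (rightEdges_eq (d := d) P ▸ hT.rightEdges_subset_goodEdges hP)

end IsPawTiling

end Components

/-! ### Tilings from chains in the weak order -/

section Construction

section Between

variable {ι : Type*} {d : ι → ℝ × ℝ}

theorem mem_between_labelSum (A L R : List ι) (z : ℝ × ℝ) :
    z ∈ between d (labelSum d A) L R ↔
      depth d A ≤ -z.2 ∧ -z.2 ≤ depth d A + depth d L ∧
      (labelSum d A).1 + xAt d L (-z.2 - depth d A) ≤ z.1 ∧
      z.1 ≤ (labelSum d A).1 + xAt d R (-z.2 - depth d A) := by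
  have hs : (labelSum d A).2 - z.2 = -z.2 - depth d A := by rw [depth]; ring
  rw [between, Set.mem_ofPred_eq, hs, sub_nonneg, sub_le_iff_le_add']

theorem between_context_subset (hd : ∀ i, (d i).2 < 0) {L R : List ι} (h : L.Perm R)
    (A B : List ι) :
    between d (labelSum d A) L R ⊆ between d 0 (A ++ L ++ B) (A ++ R ++ B) := by
  intro z hz
  rw [mem_between_labelSum] at hz
  obtain ⟨h0, h1, hleft, hright⟩ := hz
  rw [mem_between_zero, xAt_context hd B h0 h1, xAt_context hd B h0 (depth_perm h ▸ h1)]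
  refine ⟨(depth_nonneg hd A).trans h0, ?_, hleft, hright⟩
  simp only [depth_append]
  linarith [depth_nonneg hd B]

theorem mem_between_of_xAt_context_lt (hd : ∀ i, (d i).2 < 0) {A B L R : List ι}
    (h : L.Perm R) {z : ℝ × ℝ} (hz : z ∈ between d 0 (A ++ L ++ B) (A ++ R ++ B))
    (hlt : xAt d (A ++ L ++ B) (-z.2) < xAt d (A ++ R ++ B) (-z.2)) :
    z ∈ between d (labelSum d A) L R := by
  obtain ⟨-, -, hleft, hright⟩ := mem_between_zero.1 hz
  have hdepth : depth d L = depth d R := depth_perm h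
  have h0 : depth d A ≤ -z.2 := by
    by_contra! hs
    refine hlt.ne ?_
    simp only [xAt_append, depth_append, hdepth]
    rw [xAt_of_nonpos hd L (by linarith), xAt_of_nonpos hd R (by linarith)]
  have h1 : -z.2 ≤ depth d A + depth d L := by
    by_contra! hs
    refine hlt.ne ?_
    simp only [xAt_append, depth_append, hdepth]
    rw [xAt_of_depth_le hd (L := L) (by linarith), xAt_of_depth_le hd (L := R) (by linarith),
      labelSum_perm h]
  rw [xAt_context hd B h0 h1] at hleft
  rw [xAt_context hd B h0 (hdepth ▸ h1)] at hright
  exact (mem_between_labelSum A L R z).2 ⟨h0, h1, hleft, hright⟩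

theorem disjoint_interior_between_right (t : ℝ × ℝ) (U V W : List ι) :
    Disjoint (interior (between d t U V)) (between d t V W) :=
  Set.disjoint_left.2 fun _ hz hz' => (lt_of_mem_interior_between hz).2.not_ge hz'.2.2.1

theorem disjoint_interior_between_left (t : ℝ × ℝ) (U V W : List ι) :
    Disjoint (interior (between d t V W)) (between d t U V) :=
  Set.disjoint_left.2 fun _ hz hz' => (lt_of_mem_interior_between hz).1.not_ge hz'.2.2.2

theorem listEdges_subset_context (A L B : List ι) :
    listEdges d (labelSum d A) L ⊆ listEdges d 0 (A ++ L ++ B) := by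
  rw [listEdges_append, listEdges_append, zero_add]
  exact fun e he => .inl (.inr he)

theorem mem_listEdges_context_or {A B L R : List ι} (h : L.Perm R) {e : (ℝ × ℝ) × ι}
    (he : e ∈ listEdges d 0 (A ++ L ++ B)) :
    e ∈ listEdges d 0 (A ++ R ++ B) ∨ e ∈ listEdges d (labelSum d A) L := by
  rw [listEdges_append, listEdges_append, zero_add, zero_add, labelSum_append,
    labelSum_perm h, ← labelSum_append] at he
  rw [listEdges_append, listEdges_append, zero_add, zero_add]
  rcases he with (he | he) | he
  · exact .inl (.inl (.inl he))
  · exact .inr he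
  · exact .inl (.inr he)

end Between

open ElnitskyPolygon

variable {n : ℕ} {d : Fin n → ℝ × ℝ}

/-- The edge-to-edge condition for one edge `e` on one side of a tile: `e` lies on the border `S`,
or on the `near` half and not on the `far` half of a tile in `T`. -/
def IsMatched {α β : Type*} (S : Set α) (near far : β → Set α) (T : Set β) (e : α) : Prop :=
  e ∈ S ∨ ∃ Q ∈ T, e ∈ near Q ∧ e ∉ far Q

namespace IsMatched

variable {α β : Type*} {S S' : Set α} {near far : β → Set α} {T T' : Set β} {e : α}

theorem mono (h : IsMatched S near far T e) (hT : T ⊆ T') : IsMatched S near far T' e :=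
  h.imp_right fun ⟨Q, hQ, he⟩ => ⟨Q, hT hQ, he⟩

theorem trans (h : IsMatched S near far T e) (hS : ∀ e ∈ S, IsMatched S' near far T' e) :
    IsMatched S' near far (T ∪ T') e :=
  h.elim (fun he => (hS e he).mono Set.subset_union_right)
    fun ⟨Q, hQ, he⟩ => .inr ⟨Q, .inl hQ, he⟩

end IsMatched

/-- `T` is a paw tiling of the part of the plane between the paths `U ≤ W` from the origin. The last
two fields are the edge-to-edge condition for the border, where the two paths may share edges. -/
structure IsTilingBetween (d : Fin n → ℝ × ℝ) (U W : List (Fin n))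
    (T : Set (ElnitskyPolygon n)) : Prop where
  weakLE : WeakLE U W
  finite : T.Finite
  inside : ∀ P ∈ T, P.region d ⊆ between d 0 U W
  cover : ∀ z ∈ between d 0 U W, xAt d U (-z.2) < xAt d W (-z.2) → z ∈ ⋃ P ∈ T, P.region d
  no_overlap : ∀ P ∈ T, ∀ Q ∈ T, P ≠ Q → Disjoint (interior (P.region d)) (Q.region d)
  right_edge : ∀ P ∈ T, ∀ e ∈ P.rightEdges d,
    IsMatched (listEdges d 0 W) (leftEdges d) (rightEdges d) T e
  left_edge : ∀ P ∈ T, ∀ e ∈ P.leftEdges d,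
    IsMatched (listEdges d 0 U) (rightEdges d) (leftEdges d) T e
  left_border : ∀ e ∈ listEdges d 0 U,
    IsMatched (listEdges d 0 W) (leftEdges d) (rightEdges d) T e
  right_border : ∀ e ∈ listEdges d 0 W,
    IsMatched (listEdges d 0 U) (rightEdges d) (leftEdges d) T e

namespace IsTilingBetween

variable {U V W : List (Fin n)} {T T₁ T₂ : Set (ElnitskyPolygon n)}

theorem refl (U : List (Fin n)) : IsTilingBetween d U U ∅ where
  weakLE := .refl
  finite := Set.finite_empty
  inside _ hP := hP.elim
  cover _ _ h := (lt_irrefl _ h).elim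
  no_overlap _ hP := hP.elim
  right_edge _ hP := hP.elim
  left_edge _ hP := hP.elim
  left_border _ he := .inl he
  right_border _ he := .inl he

theorem mem_union_of_mem_between (h₁ : IsTilingBetween d U V T₁) (h₂ : IsTilingBetween d V W T₂)
    (hd : IsConvexEdgeSystem d) {z : ℝ × ℝ} (hz : z ∈ between d 0 U W)
    (hlt : xAt d U (-z.2) < xAt d W (-z.2)) : z ∈ ⋃ P ∈ T₁ ∪ T₂, P.region d := by
  obtain ⟨h0, hU, hleft, hright⟩ := mem_between_zero.1 hz
  have hV : -z.2 ≤ depth d V := depth_perm h₁.weakLE.perm ▸ hU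
  have hcover₁ (h : z.1 ≤ xAt d V (-z.2)) := h₁.cover z (mem_between_zero.2 ⟨h0, hU, hleft, h⟩)
  have hcover₂ (h : xAt d V (-z.2) ≤ z.1) := h₂.cover z (mem_between_zero.2 ⟨h0, hV, h, hright⟩)
  rw [Set.biUnion_union]
  rcases le_total z.1 (xAt d V (-z.2)) with h | h
  · rcases (h₁.weakLE.xAt_le hd (-z.2)).lt_or_eq with hUV | hUV
    · exact .inl (hcover₁ h hUV)
    · exact .inr (hcover₂ (hUV ▸ hleft) (hUV ▸ hlt))
  · rcases (h₂.weakLE.xAt_le hd (-z.2)).lt_or_eq with hVW | hVW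
    · exact .inr (hcover₂ h hVW)
    · exact .inl (hcover₁ (hVW ▸ hright) (hVW ▸ hlt))

theorem trans (hd : IsConvexEdgeSystem d) (h₁ : IsTilingBetween d U V T₁)
    (h₂ : IsTilingBetween d V W T₂) : IsTilingBetween d U W (T₁ ∪ T₂) where
  weakLE := Relation.ReflTransGen.trans h₁.weakLE h₂.weakLE
  finite := h₁.finite.union h₂.finite
  inside := by
    rintro P (hP | hP) z hz
    · obtain ⟨h0, hU, hleft, hright⟩ := mem_between_zero.1 (h₁.inside P hP hz)
      exact mem_between_zero.2 ⟨h0, hU, hleft, hright.trans (h₂.weakLE.xAt_le hd _)⟩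
    · obtain ⟨h0, hV, hleft, hright⟩ := mem_between_zero.1 (h₂.inside P hP hz)
      exact mem_between_zero.2 ⟨h0, depth_perm h₁.weakLE.perm ▸ hV,
        (h₁.weakLE.xAt_le hd _).trans hleft, hright⟩
  cover z hz hlt := h₁.mem_union_of_mem_between h₂ hd hz hlt
  no_overlap := by
    rintro P (hP | hP) Q (hQ | hQ) hne
    · exact h₁.no_overlap P hP Q hQ hne
    · exact (disjoint_interior_between_right 0 U V W).mono (interior_mono (h₁.inside P hP))
        (h₂.inside Q hQ)
    · exact (disjoint_interior_between_left 0 U V W).mono (interior_mono (h₂.inside P hP))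
        (h₁.inside Q hQ)
    · exact h₂.no_overlap P hP Q hQ hne
  right_edge := by
    rintro P (hP | hP) e he
    · exact (h₁.right_edge P hP e he).trans h₂.left_border
    · exact (h₂.right_edge P hP e he).mono Set.subset_union_right
  left_edge := by
    rintro P (hP | hP) e he
    · exact (h₁.left_edge P hP e he).mono Set.subset_union_left
    · exact Set.union_comm T₂ T₁ ▸ (h₂.left_edge P hP e he).trans h₁.right_border
  left_border e he := (h₁.left_border e he).trans h₂.left_border
  right_border e he := Set.union_comm T₂ T₁ ▸ (h₂.right_border e he).trans h₁.right_border

theorem single (hd : IsConvexEdgeSystem d) {P : ElnitskyPolygon n} {A : List (Fin n)}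
    (hA : labelSum d A = P.top) (B : List (Fin n)) :
    IsTilingBetween d (A ++ P.leftList ++ B) (A ++ P.rightList ++ B) {P} := by
  have hregion : P.region d = between d (labelSum d A) P.leftList P.rightList :=
    hA ▸ P.region_eq hd.down
  have hleft : P.leftEdges d = listEdges d (labelSum d A) P.leftList := hA ▸ P.leftEdges_eq
  have hright : P.rightEdges d = listEdges d (labelSum d A) P.rightList := hA ▸ P.rightEdges_eq
  exact
    { weakLE := P.weakLE.context A B
      finite := Set.finite_singleton P
      inside := forall_eq.2
        (hregion ▸ between_context_subset hd.down P.leftList_perm A B)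
      cover := fun z hz hlt => Set.mem_biUnion rfl
        (hregion ▸ mem_between_of_xAt_context_lt hd.down P.leftList_perm hz hlt)
      no_overlap := fun _ hQ _ hQ' hne => absurd (hQ.trans hQ'.symm) hne
      right_edge := forall_eq.2 fun e he =>
        .inl (listEdges_subset_context A _ B (hright ▸ he))
      left_edge := forall_eq.2 fun e he =>
        .inl (listEdges_subset_context A _ B (hleft ▸ he))
      left_border := fun e he => by
        by_cases heR : e ∈ P.rightEdges d
        · exact .inl (listEdges_subset_context A _ B (hright ▸ heR))
        · exact (mem_listEdges_context_or P.leftList_perm he).imp_right fun heL =>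
            ⟨P, rfl, hleft ▸ heL, heR⟩
      right_border := fun e he => by
        by_cases heL : e ∈ P.leftEdges d
        · exact .inl (listEdges_subset_context A _ B (hleft ▸ heL))
        · exact (mem_listEdges_context_or P.leftList_perm.symm he).imp_right fun heR =>
            ⟨P, rfl, hright ▸ heR, heL⟩ }

theorem isPawTiling (hd : ∀ i, (d i).2 < 0) {w : Equiv.Perm (Fin n)}
    (h : IsTilingBetween d (List.ofFn (1 : Equiv.Perm (Fin n))) (List.ofFn w) T) :
    IsPawTiling d w T where
  finite := h.finite
  inside P hP := (h.inside P hP).trans_eq (region_X hd w).symm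
  cover z hz := by
    rw [region_X hd] at hz
    obtain ⟨hleft, hright⟩ := lt_of_mem_interior_between hz
    exact h.cover z (interior_subset hz) (by simpa using hleft.trans hright)
  no_overlap := h.no_overlap
  right_edge := by
    rw [rightEdges_eq]
    exact h.right_edge
  left_edge := by
    rw [leftEdges_eq]
    exact h.left_edge

end IsTilingBetween

/-- The rhombus with top vertex `t` and labels `a < b`. -/
def rhombus (t : ℝ × ℝ) {a b : Fin n} (hab : a < b) : ElnitskyPolygon n where
  size := 2
  top := t
  label := OrderEmbedding.ofStrictMono ![a, b] (by simpa [Fin.strictMono_iff_lt_succ] using hab)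
  perm := Equiv.swap 0 1

theorem rhombus_isRhombus (t : ℝ × ℝ) {a b : Fin n} (hab : a < b) : (rhombus t hab).IsRhombus :=
  ⟨t, _, rfl⟩

theorem rhombus_leftList (t : ℝ × ℝ) {a b : Fin n} (hab : a < b) :
    (rhombus t hab).leftList = [a, b] :=
  rfl

theorem rhombus_rightList (t : ℝ × ℝ) {a b : Fin n} (hab : a < b) :
    (rhombus t hab).rightList = [b, a] :=
  rfl

theorem ElnitskyPolygon.IsRhombus.exists_eq {Q : ElnitskyPolygon n} (h : Q.IsRhombus) :
    ∃ (t : ℝ × ℝ) (a b : Fin n) (hab : a < b), Q = rhombus t hab := by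
  obtain ⟨t, l, rfl⟩ := h
  exact ⟨t, l 0, l 1, l.strictMono Fin.zero_lt_one,
    congrArg (ElnitskyPolygon.mk 2 t · (Equiv.swap 0 1))
      (RelEmbedding.ext fun i => by fin_cases i <;> rfl)⟩

theorem IsTilingBetween.of_rhombus (hd : IsConvexEdgeSystem d) (A B : List (Fin n)) {a b : Fin n}
    (hab : a < b) :
    IsTilingBetween d (A ++ a :: b :: B) (A ++ b :: a :: B) {rhombus (labelSum d A) hab} := by
  simpa [rhombus_leftList, rhombus_rightList] using
    IsTilingBetween.single hd (P := rhombus (labelSum d A) hab) rfl B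

theorem WeakLE.exists_rhombus_tiling (hd : IsConvexEdgeSystem d) {U W : List (Fin n)}
    (h : WeakLE U W) : ∃ T, IsTilingBetween d U W T ∧ ∀ P ∈ T, P.IsRhombus := by
  induction h with
  | refl => exact ⟨∅, .refl U, fun _ hP => hP.elim⟩
  | tail _ hstep ih =>
    obtain ⟨T, hT, hrhombus⟩ := ih
    obtain ⟨A, B, a, b, hab, rfl, rfl⟩ := hstep
    refine ⟨T ∪ {rhombus (labelSum d A) hab}, hT.trans hd (.of_rhombus hd A B hab), ?_⟩
    rintro P (hP | rfl)
    · exact hrhombus P hP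
    · exact rhombus_isRhombus _ _

theorem exists_pawTiling_of_path (hd : IsConvexEdgeSystem d) {w : Equiv.Perm (Fin n)}
    {P : ElnitskyPolygon n} {A B : List (Fin n)} (hA : labelSum d A = P.top)
    {T₂ : Set (ElnitskyPolygon n)}
    (hT₂ : IsTilingBetween d (A ++ P.rightList ++ B) (List.ofFn w) T₂)
    (hrhombus₂ : ∀ Q ∈ T₂, Q.IsRhombus) :
    ∃ T, IsPawTiling d w T ∧ P ∈ T ∧ T₂ ⊆ T ∧ ∀ Q ∈ T, Q ≠ P → Q.IsRhombus := by
  have hP := IsTilingBetween.single hd hA B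
  obtain ⟨T₁, hT₁, hrhombus₁⟩ := WeakLE.exists_rhombus_tiling hd
    (weakLE_of_pairwise_lt pairwise_lt_ofFn_one ((weakLE_ofFn_one w).perm.trans
      (hP.weakLE.perm.trans hT₂.weakLE.perm).symm))
  refine ⟨T₁ ∪ {P} ∪ T₂, ((hT₁.trans hd hP).trans hd hT₂).isPawTiling hd.down, .inl (.inr rfl),
    Set.subset_union_right, ?_⟩
  rintro Q ((hQ | hQ) | hQ) hne
  · exact hrhombus₁ Q hQ
  · exact absurd hQ hne
  · exact hrhombus₂ Q hQ

end Construction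

/-! ### Isolated paws -/

section Isolation

open ElnitskyPolygon

section ListEdges

variable {ι : Type*} {d : ι → ℝ × ℝ}

theorem listEdges_vertex_unique {t v v' : ℝ × ℝ} {a : ι} {L : List ι} (hL : L.Nodup)
    (h : (v, a) ∈ listEdges d t L) (h' : (v', a) ∈ listEdges d t L) : v = v' := by
  obtain ⟨A, B, rfl, rfl⟩ := mem_listEdges_iff.1 h
  obtain ⟨A', B', hA', rfl⟩ := mem_listEdges_iff.1 h'
  obtain ⟨hA, hB⟩ : a ∉ A' ∧ a ∉ B' := by
    simpa using (List.nodup_cons.1 (List.nodup_middle.1 (hA' ▸ hL))).1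
  rw [((List.append_cons_inj_of_notMem hA hB).1 hA'.symm).1]

end ListEdges

variable {n : ℕ} {d : Fin n → ℝ × ℝ} {t : ℝ × ℝ} {a b : Fin n} {hab : a < b}
  {P : ElnitskyPolygon n}

theorem ElnitskyPolygon.rightList_nodup (P : ElnitskyPolygon n) : P.rightList.Nodup :=
  P.leftList_perm.nodup_iff.1 P.leftList_sorted.nodup

theorem mem_rhombus_edges {v : ℝ × ℝ} {x : Fin n}
    (h : (v, x) ∈ (rhombus t hab).leftEdges d ∪ (rhombus t hab).rightEdges d) :
    x = a ∧ (v = t ∨ v = t + d b) ∨ x = b ∧ (v = t ∨ v = t + d a) := by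
  have htop : (rhombus t hab).top = t := rfl
  simp only [leftEdges_eq, rightEdges_eq, rhombus_leftList, rhombus_rightList, htop,
    listEdges_cons, listEdges_nil, Set.mem_union, Set.mem_insert_iff, Set.mem_empty_iff_false,
    Prod.mk.injEq, or_false] at h
  tauto

theorem SharesTwoRightEdges.exists_edges (h : SharesTwoRightEdges d (rhombus t hab) P) :
    ∃ v v', (v = t ∨ v = t + d b) ∧ (v' = t ∨ v' = t + d a) ∧
      (v, a) ∈ P.rightEdges d ∧ (v', b) ∈ P.rightEdges d := by
  obtain ⟨⟨v, x⟩, ⟨v', x'⟩, hne, hQ, hQ', hP, hP'⟩ := h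
  have hlabel : x ≠ x' := by
    rintro rfl
    rw [rightEdges_eq] at hP hP'
    exact hne (by rw [listEdges_vertex_unique P.rightList_nodup hP hP'])
  rcases mem_rhombus_edges hQ with ⟨rfl, hv⟩ | ⟨rfl, hv⟩ <;>
    rcases mem_rhombus_edges hQ' with ⟨rfl, hv'⟩ | ⟨rfl, hv'⟩
  · exact absurd rfl hlabel
  · exact ⟨v, v', hv, hv', hP, hP'⟩
  · exact ⟨v', v, hv', hv, hP', hP⟩
  · exact absurd rfl hlabel

theorem not_disjoint_rhombus (hd : IsConvexEdgeSystem d) {A B : List (Fin n)}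
    (hR : P.rightList = A ++ b :: a :: B) :
    ¬ Disjoint (interior (P.region d)) ((rhombus (P.top + labelSum d A) hab).region d) := by
  have hP := P.eventually_mem_interior_left_of_right hd hR hab
  have hQ := (rhombus (P.top + labelSum d A) hab).eventually_mem_interior_left_of_right hd
    (A := []) (rhombus_rightList _ hab) hab
  rw [List.nil_append, labelSum_cons, labelSum_nil, add_zero] at hQ
  rw [labelSum_append, labelSum_cons, labelSum_nil, add_zero, ← add_assoc] at hP
  obtain ⟨δ, hδP, hδQ⟩ := (hP.and hQ).exists
  exact Set.not_disjoint_iff.2 ⟨_, hδP, interior_subset hδQ⟩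

/-- The labels of the shared edges cannot be in the order `b, a`: the two edges would be the right
half of the rhombus, which then overlaps `P`. -/
theorem SharesTwoRightEdges.pair_sublist (hd : IsConvexEdgeSystem d)
    (hdisj : Disjoint (interior (P.region d)) ((rhombus t hab).region d))
    (h : SharesTwoRightEdges d (rhombus t hab) P) : [a, b].Sublist P.rightList := by
  obtain ⟨v, v', hv, hv', hPa, hPb⟩ := h.exists_edges
  rw [rightEdges_eq, mem_listEdges_iff] at hPa hPb
  obtain ⟨A, B, hR, hvA⟩ := hPa
  obtain ⟨A', B', hR', hvA'⟩ := hPb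
  rcases List.append_eq_append_iff.1 (hR.symm.trans hR') with ⟨C, rfl, hC⟩ | ⟨C, rfl, hC⟩ <;>
    rcases C with _ | ⟨c, C⟩
  · exact absurd (List.cons.inj hC).1 hab.ne
  · obtain ⟨rfl, rfl⟩ := List.cons.inj hC
    simp [hR]
  · exact absurd (List.cons.inj hC).1 hab.ne'
  obtain ⟨rfl, rfl⟩ := List.cons.inj hC
  have hstep : v.2 = v'.2 + (d b).2 + (labelSum d C).2 := by
    simp [hvA, hvA', add_assoc]
  have hCnonpos := labelSum_snd_nonpos hd.down C
  rcases hv with rfl | rfl <;> rcases hv' with rfl | rfl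
  · linarith [hd.down b]
  · rw [Prod.snd_add] at hstep
    linarith [hd.down a, hd.down b]
  · rw [Prod.snd_add] at hstep
    obtain rfl := eq_nil_of_labelSum_snd_eq_zero hd.down (L := C) (by linarith)
    rw [hvA'] at hdisj
    exact absurd hdisj (not_disjoint_rhombus hd (by simpa using hR))
  · simp only [Prod.snd_add] at hstep
    linarith [hd.down a]

theorem sharesTwoRightEdges_rhombus {A B : List (Fin n)} (hR : P.rightList = A ++ a :: b :: B) :
    SharesTwoRightEdges d (rhombus (P.top + labelSum d A) hab) P := by
  refine ⟨(P.top + labelSum d A, a), (P.top + labelSum d A + d a, b),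
    fun h => hab.ne (congrArg Prod.snd h), .inl ?_, .inl ?_, ?_, ?_⟩
  · exact leftEdges_eq (d := d) (rhombus _ hab) ▸
      mem_listEdges_iff.2 ⟨[], [b], rfl, by simp [rhombus]⟩
  · exact leftEdges_eq (d := d) (rhombus _ hab) ▸
      mem_listEdges_iff.2 ⟨[a], [], rfl, by simp [rhombus]⟩
  · exact rightEdges_eq (d := d) P ▸ mem_listEdges_iff.2 ⟨A, b :: B, hR, rfl⟩
  · exact rightEdges_eq (d := d) P ▸
      mem_listEdges_iff.2 ⟨A ++ [a], B, by simpa using hR, by simp [add_assoc]⟩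

theorem rhombus_ne_of_pair_sublist (h : [a, b].Sublist P.rightList) : rhombus t hab ≠ P := by
  rintro rfl
  exact not_pair_sublist_swap (rightList_nodup _) h (List.Sublist.refl _)

variable {w : Equiv.Perm (Fin n)}

theorem isIsolatedPaw_of_rightList_sublist (hd : IsConvexEdgeSystem d)
    (h : P.rightList.Sublist (List.ofFn w)) : IsIsolatedPaw d w P := by
  intro T hT hP hrhombus Q hQ hne hshare
  obtain ⟨t, a, b, hab, rfl⟩ := (hrhombus Q hQ hne).exists_eq
  have hab_w : [a, b].Sublist (List.ofFn w) :=
    (hshare.pair_sublist hd (hT.no_overlap P hP _ hQ hne.symm)).trans h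
  obtain ⟨A, B, -, hle⟩ := hT.exists_weakLE hd hQ (List.cons_ne_nil b [a])
  have hba_w : [b, a].Sublist (List.ofFn w) := hle.inversion hab
    ((List.sublist_append_right A _).trans (List.sublist_append_left _ B))
  exact not_pair_sublist_swap (List.nodup_ofFn.2 w.injective) hab_w hba_w

namespace IsIsolatedPaw

variable {A B : List (Fin n)}

theorem not_inversion (hd : IsConvexEdgeSystem d) (hP : IsIsolatedPaw d w P)
    (hA : labelSum d A = P.top) (hle : WeakLE (A ++ P.rightList ++ B) (List.ofFn w))
    {R₁ R₂ : List (Fin n)} (hR : P.rightList = R₁ ++ a :: b :: R₂) (hab : a < b) :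
    ¬ [b, a].Sublist (List.ofFn w) := by
  intro hba
  have hpath : A ++ P.rightList ++ B = (A ++ R₁) ++ a :: b :: (R₂ ++ B) := by simp [hR]
  obtain ⟨T₂, hT₂, hrhombus₂⟩ := WeakLE.exists_rhombus_tiling hd
    ((hpath ▸ hle).swap_of_inversion (List.nodup_ofFn.2 w.injective) hba)
  have hT₂' := hpath ▸ (IsTilingBetween.of_rhombus hd (A ++ R₁) (R₂ ++ B) hab).trans hd hT₂
  obtain ⟨T, hT, hPT, hsub, hrhombus⟩ := exists_pawTiling_of_path hd hA hT₂' (by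
    rintro Q (rfl | hQ)
    · exact rhombus_isRhombus _ hab
    · exact hrhombus₂ Q hQ)
  have htop : labelSum d (A ++ R₁) = P.top + labelSum d R₁ := by rw [labelSum_append, hA]
  refine hP T hT hPT hrhombus _ (hsub (.inl rfl))
    (rhombus_ne_of_pair_sublist (by simp [hR])) ?_
  exact htop ▸ sharesTwoRightEdges_rhombus hR

theorem rightList_sublist (hd : IsConvexEdgeSystem d) (hP : IsIsolatedPaw d w P)
    (hA : labelSum d A = P.top) (hle : WeakLE (A ++ P.rightList ++ B) (List.ofFn w)) :
    P.rightList.Sublist (List.ofFn w) := by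
  have hw (i : Fin n) : i ∈ List.ofFn w := List.mem_ofFn.2 (w.surjective i)
  refine sublist_of_forall_adjacent (List.nodup_ofFn.2 w.injective) (fun i _ => hw i) ?_
  intro R₁ R₂ a b hR
  have hne : a ≠ b := by
    rintro rfl
    simpa [hR, List.nodup_append] using P.rightList_nodup
  rcases hne.lt_or_gt with hab | hba
  · exact (pair_sublist_or_swap hne (hw a) (hw b)).resolve_right
      (hP.not_inversion hd hA hle hR hab)
  · exact hle.inversion hba (by simp [hR])

end IsIsolatedPaw

end Isolation

theorem corollary4p11_general {n k : ℕ} {d : Fin n → ℝ × ℝ} (hd : IsConvexEdgeSystem d)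
    (w : Equiv.Perm (Fin n)) (p : Equiv.Perm (Fin k)) :
    (∃ T : Set (ElnitskyPolygon n), IsPawTiling d w T ∧
      ∃ P ∈ T, P.IsPaw p ∧ IsIsolatedPaw d w P) ↔
    ValueStable p w := by
  rw [valueStable_iff]
  constructor
  · rintro ⟨T, hT, P, hPT, ⟨t, l, rfl⟩, hP⟩
    by_cases hne : List.ofFn (l ∘ p) = []
    · exact ⟨l, List.ofFn w, .refl, hne ▸ List.nil_infix, hne ▸ List.nil_sublist _⟩
    · obtain ⟨A, B, hA, hle⟩ := hT.exists_weakLE hd hPT hne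
      exact ⟨l, _, hle, ⟨A, B, rfl⟩, hP.rightList_sublist hd hA hle⟩
  · rintro ⟨l, _, hle, ⟨A, B, rfl⟩, hsub⟩
    obtain ⟨T₂, hT₂, hrhombus₂⟩ := hle.exists_rhombus_tiling hd
    obtain ⟨T, hT, hPT, -⟩ :=
      exists_pawTiling_of_path (P := ⟨k, labelSum d A, l, p⟩) hd rfl hT₂ hrhombus₂
    exact ⟨T, hT, _, hPT, ⟨_, l, rfl⟩, isIsolatedPaw_of_rightList_sublist hd hsub⟩

theorem corollary4p11 {n k : ℕ} (d : Fin n → ℝ × ℝ) (hd : IsEdgeSystem d)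
    (w : Equiv.Perm (Fin n)) (p : Equiv.Perm (Fin k)) :
    (∃ T : Set (ElnitskyPolygon n), IsPawTiling d w T ∧
      ∃ P ∈ T, P.IsPaw p ∧ IsIsolatedPaw d w P) ↔
    ValueStable p w :=
  corollary4p11_general hd.isConvexEdgeSystem w p
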